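/- Let $(M,g)$ be a smooth compact simply connected Riemannian $2$-manifold (Hausdorff, without boundary), equipped with an orientation; write $\nabla_g$ for the gradient, $\nabla_g^\perp = \mathbb J\nabla_g$ for the skew gradient, where $\mathbb J$ is the rotation of the oriented tangent planes given by $(a,b)\mapsto(b,-a)$ in positively oriented orthonormal frames, $\nabla_{g_X}Y$ for the Levi-Civita covariant derivative of $Y$ in direction $X$, $\Delta_M$ for the Laplace–Beltrami operator, and $dv_g$ for the Riemannian volume measure. For $u = u_1+iu_2 : M\to\mathbb C$ of class $C^1$ let $j(u) = (iu)\cdot\nabla_g u = -u_2\nabla_g u_1+u_1\nabla_g u_2$, and define the weak Jacobian by $$\langle J(u),\eta\rangle = \frac12\int_M\langle j(u),\nabla_g^\perp\eta\rangle_g\,dv_g .$$ Let $\varepsilon>0$, let $u_0:M\to\mathbb C$, and let $u:M\times[0,\infty)\to\mathbb C$ be a classical solution of the Gross–Pitaevskii equation $$ i u_t-\Delta_M u=\frac{u}{\varepsilon^2}\,(1-|u|^2)\quad\text{in } M\times(0,\infty),\qquad u(\cdot,0)=u_0, $$ that is, $u$ is continuous on $M\times[0,\infty)$, $u_t$ exists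 and is continuous on $M\times(0,\infty)$, $u(\cdot,t)\in C^2(M)$ for every $t>0$, and the equation and the initial condition hold pointwise. Then for every smooth $\eta:M\to\mathbb R$ and every $t>0$ the integrals below and in the definition of $\langle J(u(\cdot,t)),\eta\rangle$ converge absolutely, the function $t\mapsto\langle J(u(\cdot,t)),\eta\rangle$ is differentiable at $t$, and $$\frac{d}{dt}\langle J(u),\eta\rangle=-\int_M\big\langle\nabla_g u,\nabla_{g_{\nabla_g u}}\nabla_g^\perp\eta\big\rangle_g\,dv_g :=-\int_M\sum_{k=1}^2\big\langle\nabla_g u_k,\nabla_{g_{\nabla_g u_k}}\nabla_g^\perp\eta\big\rangle_g\,dv_g .$$ -/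

import Mathlib

open Set Filter Topology MeasureTheory Bundle
open scoped Manifold ContDiff

noncomputable section

namespace GrossPitaevskii

section Metric

/-! ### Gradient and connection on a Riemannian manifold

Throughout, a Riemannian metric on `M` is a smoothly varying inner product on the tangent spaces
(`RiemannianBundle` and `IsContMDiffRiemannianBundle`). -/

variable {E : Type*} [NormedAddCommGroup E] [NormedSpace ℝ E] [FiniteDimensional ℝ E]
  {H : Type*} [TopologicalSpace H] {I : ModelWithCorners ℝ E H}
  {M : Type*} [TopologicalSpace M] [ChartedSpace H M]
  [RiemannianBundle (fun x : M => TangentSpace I x)]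

instance finiteDimensional_tangentSpace (x : M) : FiniteDimensional ℝ (TangentSpace I x) :=
  inferInstanceAs (FiniteDimensional ℝ E)

instance completeSpace_tangentSpace (x : M) : CompleteSpace (TangentSpace I x) :=
  FiniteDimensional.complete ℝ _

variable (I) in
/-- The Riemannian gradient `∇_g f`, characterised by `⟪∇_g f, w⟫ = df(w)`. -/
def grad (f : M → ℝ) (x : M) : TangentSpace I x :=
  (InnerProductSpace.toDual ℝ (TangentSpace I x)).symm (mvfderiv I f x)

/-! ### The Levi-Civita connection -/

/-- The right-hand side of the Koszul formula for `⟪∇_X Y, Z⟫` at `x`. -/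
def koszul (Y X Z : Π x : M, TangentSpace I x) (x : M) : ℝ :=
  (1 / 2 : ℝ) *
    (mvfderiv I (fun y => (inner ℝ (Y y) (Z y) : ℝ)) x (X x)
      + mvfderiv I (fun y => (inner ℝ (X y) (Z y) : ℝ)) x (Y x)
      - mvfderiv I (fun y => (inner ℝ (X y) (Y y) : ℝ)) x (Z x)
      + inner ℝ (VectorField.mlieBracket I X Y x) (Z x)
      - inner ℝ (VectorField.mlieBracket I X Z x) (Y x)
      - inner ℝ (VectorField.mlieBracket I Y Z x) (X x))

variable [IsManifold I ∞ M]
  [IsContMDiffRiemannianBundle I ∞ E (fun x : M => TangentSpace I x)]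

theorem mdifferentiableAt_inner {X Y : Π x : M, TangentSpace I x} {x : M}
    (hX : MDiffAt (T% X) x) (hY : MDiffAt (T% Y) x) :
    MDiffAt (fun y => (inner ℝ (X y) (Y y) : ℝ)) x := by
  have : IsContMDiffRiemannianBundle I 1 E (fun x : M => TangentSpace I x) := inferInstance
  exact MDifferentiableAt.inner_bundle (E := fun x : M => TangentSpace I x) hX hY

theorem koszul_tensorial_left {Y Z : Π x : M, TangentSpace I x} {x : M}
    (hY : MDiffAt (T% Y) x) (hZ : MDiffAt (T% Z) x) :
    TensorialAt I E (fun X => koszul Y X Z x) x where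
  smul {f X} hf hX := by
    have : CompleteSpace E := FiniteDimensional.complete ℝ E
    have h1 := mvfderiv_fun_mul hf (mdifferentiableAt_inner hX hZ)
    have h2 := mvfderiv_fun_mul hf (mdifferentiableAt_inner hX hY)
    have h3 := VectorField.mlieBracket_smul_left (W := Y) hf hX
    have h4 := VectorField.mlieBracket_smul_left (W := Z) hf hX
    simp [koszul, inner_smul_left, h1, h2, h3, h4, inner_add_left, inner_smul_right]
    ring
  add {X X'} hX hX' := by
    have : CompleteSpace E := FiniteDimensional.complete ℝ E
    have h1 := mvfderiv_fun_add (mdifferentiableAt_inner hX hZ) (mdifferentiableAt_inner hX' hZ)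
    have h2 := mvfderiv_fun_add (mdifferentiableAt_inner hX hY) (mdifferentiableAt_inner hX' hY)
    have h3 := VectorField.mlieBracket_add_left (W := Y) hX hX'
    have h4 := VectorField.mlieBracket_add_left (W := Z) hX hX'
    simp [koszul, h1, h2, h3, h4, inner_add_left, inner_add_right]
    ring

theorem koszul_tensorial_right {Y X : Π x : M, TangentSpace I x} {x : M}
    (hY : MDiffAt (T% Y) x) (hX : MDiffAt (T% X) x) :
    TensorialAt I E (fun Z => koszul Y X Z x) x where
  smul {f Z} hf hZ := by
    have : CompleteSpace E := FiniteDimensional.complete ℝ E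
    have h1 := mvfderiv_fun_mul hf (mdifferentiableAt_inner hY hZ)
    have h2 := mvfderiv_fun_mul hf (mdifferentiableAt_inner hX hZ)
    have h3 := VectorField.mlieBracket_smul_right (V := Y) hf hZ
    have h4 := VectorField.mlieBracket_smul_right (V := X) hf hZ
    simp [koszul, inner_smul_right, h1, h2, h3, h4,
      inner_add_left, inner_smul_left, real_inner_comm]
    ring
  add {Z Z'} hZ hZ' := by
    have : CompleteSpace E := FiniteDimensional.complete ℝ E
    have h1 := mvfderiv_fun_add (mdifferentiableAt_inner hY hZ) (mdifferentiableAt_inner hY hZ')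
    have h2 := mvfderiv_fun_add (mdifferentiableAt_inner hX hZ) (mdifferentiableAt_inner hX hZ')
    have h3 := VectorField.mlieBracket_add_right (V := Y) hZ hZ'
    have h4 := VectorField.mlieBracket_add_right (V := X) hZ hZ'
    simp [koszul, h1, h2, h3, h4, inner_add_left, inner_add_right]
    ring

theorem koszul_add {Y Y' X Z : Π x : M, TangentSpace I x} {x : M}
    (hY : MDiffAt (T% Y) x) (hY' : MDiffAt (T% Y') x) (hX : MDiffAt (T% X) x)
    (hZ : MDiffAt (T% Z) x) :
    koszul (Y + Y') X Z x = koszul Y X Z x + koszul Y' X Z x := by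
  have : CompleteSpace E := FiniteDimensional.complete ℝ E
  have h1 := mvfderiv_fun_add (mdifferentiableAt_inner hY hZ) (mdifferentiableAt_inner hY' hZ)
  have h2 := mvfderiv_fun_add (mdifferentiableAt_inner hX hY) (mdifferentiableAt_inner hX hY')
  have h3 := VectorField.mlieBracket_add_left (W := Z) hY hY'
  have h4 := VectorField.mlieBracket_add_right (V := X) hY hY'
  simp [koszul, h1, h2, h3, h4, inner_add_left, inner_add_right]
  ring

theorem koszul_leibniz {Y X Z : Π x : M, TangentSpace I x} {f : M → ℝ} {x : M}
    (hY : MDiffAt (T% Y) x) (hf : MDiffAt f x) (hX : MDiffAt (T% X) x)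
    (hZ : MDiffAt (T% Z) x) :
    koszul (f • Y) X Z x = f x * koszul Y X Z x + mvfderiv I f x (X x) * inner ℝ (Y x) (Z x) := by
  have : CompleteSpace E := FiniteDimensional.complete ℝ E
  have h1 := mvfderiv_fun_mul hf (mdifferentiableAt_inner hY hZ)
  have h2 := mvfderiv_fun_mul hf (mdifferentiableAt_inner hX hY)
  have h3 := VectorField.mlieBracket_smul_left (W := Z) hf hY
  have h4 := VectorField.mlieBracket_smul_right (V := X) hf hY
  simp [koszul, inner_smul_left, h1, h2, h3, h4, inner_add_left, inner_smul_right]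
  rw [real_inner_comm (X x) (Y x)]
  ring

open Classical in
/-- The map `v ↦ ∇_v Y` at `x`: for `Y` differentiable at `x`, the vector `∇_v Y` is given by the
Koszul formula `⟪∇_X Y, Z⟫ = koszul Y X Z`, whose right-hand side is tensorial in `X` and `Z`. -/
def leviCivitaFun (Y : Π x : M, TangentSpace I x) (x : M) :
    TangentSpace I x →L[ℝ] TangentSpace I x :=
  if hY : MDiffAt (T% Y) x then
    LinearMap.toContinuousLinearMap
      { toFun := fun v => (InnerProductSpace.toDual ℝ (TangentSpace I x)).symm
          (TensorialAt.mkHom₂ (fun X Z => koszul Y X Z x) x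
            (fun _ hZ => koszul_tensorial_left hY hZ)
            (fun _ hX => koszul_tensorial_right hY hX) v)
        map_add' := by intros; simp
        map_smul' := by intros; simp }
  else 0

theorem inner_leviCivitaFun {Y X Z : Π x : M, TangentSpace I x} {x : M}
    (hY : MDiffAt (T% Y) x) (hX : MDiffAt (T% X) x) (hZ : MDiffAt (T% Z) x) :
    inner ℝ (leviCivitaFun Y x (X x)) (Z x) = koszul Y X Z x := by
  rw [leviCivitaFun, dif_pos hY]
  change inner ℝ ((InnerProductSpace.toDual ℝ (TangentSpace I x)).symm
    (TensorialAt.mkHom₂ (fun X Z => koszul Y X Z x) x _ _ (X x))) (Z x) = _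
  rw [InnerProductSpace.toDual_symm_apply]
  exact TensorialAt.mkHom₂_apply (Φ := fun X Z => koszul Y X Z x) _ _ hX hZ

theorem exists_extension (x : M) (v : TangentSpace I x) :
    ∃ V : Π x : M, TangentSpace I x, MDiffAt (T% V) x ∧ V x = v :=
  ⟨FiberBundle.extend E v, FiberBundle.mdifferentiableAt_extend .., by simp⟩

variable (I M) in
/-- The Levi-Civita connection of a Riemannian manifold: the torsion-free metric connection
(see `leviCivita_torsion` and `leviCivita_isMetricCompatible`). As always in Mathlib,
`leviCivita I M Y x v` is `∇_v Y` at `x`. -/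
def leviCivita : CovariantDerivative I E (fun x : M => TangentSpace I x) where
  toFun := leviCivitaFun
  isCovariantDerivativeOnUniv :=
    { add := by
        intro Y Y' x hY hY' _
        ext v
        obtain ⟨X, hX, rfl⟩ := exists_extension x v
        refine ext_inner_right ℝ fun w => ?_
        obtain ⟨Z, hZ, rfl⟩ := exists_extension x w
        have hYY' : MDiffAt (T% (Y + Y')) x := mdifferentiableAt_add_section hY hY'
        rw [add_apply, inner_add_left, inner_leviCivitaFun hYY' hX hZ,
          inner_leviCivitaFun hY hX hZ, inner_leviCivitaFun hY' hX hZ, koszul_add hY hY' hX hZ]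
      leibniz := by
        intro Y f x hY hf _
        ext v
        obtain ⟨X, hX, rfl⟩ := exists_extension x v
        refine ext_inner_right ℝ fun w => ?_
        obtain ⟨Z, hZ, rfl⟩ := exists_extension x w
        have hfY : MDiffAt (T% (f • Y)) x := hf.smul_section hY
        rw [inner_leviCivitaFun hfY hX hZ, koszul_leibniz hY hf hX hZ]
        simp [inner_add_left, inner_smul_left, inner_leviCivitaFun hY hX hZ] }

theorem inner_leviCivita {Y X Z : Π x : M, TangentSpace I x} {x : M}
    (hY : MDiffAt (T% Y) x) (hX : MDiffAt (T% X) x) (hZ : MDiffAt (T% Z) x) :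
    inner ℝ (leviCivita I M Y x (X x)) (Z x) = koszul Y X Z x :=
  inner_leviCivitaFun hY hX hZ

theorem leviCivita_torsion {X Y : Π x : M, TangentSpace I x} {x : M}
    (hX : MDiffAt (T% X) x) (hY : MDiffAt (T% Y) x) :
    leviCivita I M Y x (X x) - leviCivita I M X x (Y x) = VectorField.mlieBracket I X Y x := by
  refine ext_inner_right ℝ fun w => ?_
  obtain ⟨Z, hZ, rfl⟩ := exists_extension x w
  rw [inner_sub_left, inner_leviCivita hY hX hZ, inner_leviCivita hX hY hZ]
  simp only [koszul, VectorField.mlieBracket_swap_apply (V := Y) (W := X), inner_neg_left]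
  simp only [real_inner_comm]
  ring

theorem leviCivita_isMetricCompatible {X Y Z : Π x : M, TangentSpace I x} {x : M}
    (hX : MDiffAt (T% X) x) (hY : MDiffAt (T% Y) x) (hZ : MDiffAt (T% Z) x) :
    mvfderiv I (fun y => (inner ℝ (Y y) (Z y) : ℝ)) x (X x)
      = inner ℝ (leviCivita I M Y x (X x)) (Z x) + inner ℝ (Y x) (leviCivita I M Z x (X x)) := by
  rw [real_inner_comm _ (Y x), inner_leviCivita hY hX hZ, inner_leviCivita hZ hX hY]
  simp only [koszul, VectorField.mlieBracket_swap_apply (V := Z) (W := Y), inner_neg_left]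
  simp only [real_inner_comm]
  ring

variable (I) in
/-- The divergence `div X = tr (v ↦ ∇_v X)`. -/
def divergence (X : Π x : M, TangentSpace I x) (x : M) : ℝ :=
  LinearMap.trace ℝ (TangentSpace I x) (leviCivita I M X x : TangentSpace I x →ₗ[ℝ] _)

variable (I) in
/-- The Laplace-Beltrami operator `div ∇_g f` on real functions. -/
def laplaceBeltrami (f : M → ℝ) (x : M) : ℝ :=
  divergence I (grad I f) x

end Metric

section Surface

/-! ### Surfaces

A smooth surface without boundary is a manifold modelled on the plane, with the model `𝓡 2`. -/

/-- The model plane. -/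
abbrev Plane : Type := EuclideanSpace ℝ (Fin 2)

variable {M : Type*} [TopologicalSpace M] [ChartedSpace Plane M] [IsManifold (𝓡 2) ∞ M]

instance fact_finrank_tangentSpace (x : M) :
    Fact (Module.finrank ℝ (TangentSpace (𝓡 2) x) = 2) :=
  ⟨finrank_euclideanSpace_fin (𝕜 := ℝ) (n := 2)⟩

variable (M) in
/-- An orientation of a smooth surface: a choice of orientation of every tangent plane which,
read in the coordinates of any chart, is locally constant. -/
structure SurfaceOrientation where
  /-- The orientation of the tangent plane at a point. -/
  orient : Π x : M, Orientation ℝ (TangentSpace (𝓡 2) x) (Fin 2)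
  locally_constant : ∀ x₀ : M, ∀ᶠ x in 𝓝 x₀,
    ∀ hx : x ∈ (trivializationAt Plane (TangentSpace (𝓡 2)) x₀).baseSet,
      Orientation.map (Fin 2)
          ((trivializationAt Plane (TangentSpace (𝓡 2)) x₀).linearEquivAt ℝ x hx) (orient x)
        = Orientation.map (Fin 2)
          ((trivializationAt Plane (TangentSpace (𝓡 2)) x₀).linearEquivAt ℝ x₀
            (FiberBundle.mem_baseSet_trivializationAt' x₀)) (orient x₀)

variable [RiemannianBundle (fun x : M => TangentSpace (𝓡 2) x)]

/-- The `i`-th coordinate vector field of the chart at `c`, at the point with coordinates `y`. -/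
def coordVec (c : M) (y : Plane) (i : Fin 2) :
    TangentSpace (𝓡 2) ((extChartAt (𝓡 2) c).symm y) :=
  mfderiv 𝓘(ℝ, Plane) (𝓡 2) (extChartAt (𝓡 2) c).symm y (EuclideanSpace.single i (1 : ℝ))

/-- The matrix `(g_ij)` of the metric in the chart at `c`, at the point with coordinates `y`. -/
def metricMatrix (c : M) (y : Plane) : Matrix (Fin 2) (Fin 2) ℝ :=
  Matrix.of fun i j => (inner ℝ (coordVec c y i) (coordVec c y j) : ℝ)

/-- The measure `√(det g) dx₁ dx₂` on the domain of the chart at `c`, extended by zero to `M`. -/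
def chartVolume [MeasurableSpace M] (c : M) : Measure M :=
  (((volume : Measure Plane).restrict (extChartAt (𝓡 2) c).target).withDensity
    fun y => ENNReal.ofReal (Real.sqrt (metricMatrix c y).det)).map (extChartAt (𝓡 2) c).symm

variable (M) in
/-- The Riemannian volume measure `dv_g`. The measures `√(det g) dx₁ dx₂` of two charts agree on
the overlap of their domains; `dv_g`, which restricts to each of them on the domain of the chart,
is therefore their supremum (the least measure that is at least each of them). -/
def riemannianVolume [MeasurableSpace M] : Measure M :=
  ⨆ c : M, chartVolume c

/-- The skew gradient `∇_g^⊥ η = 𝕁 ∇_g η`, with `𝕁` the rotation `(a, b) ↦ (b, -a)` by the angle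
`-π/2` (Mathlib's `rightAngleRotation` is the rotation `(a, b) ↦ (-b, a)` by `π/2`). -/
def skewGrad (o : SurfaceOrientation M) (η : M → ℝ) (x : M) : TangentSpace (𝓡 2) x :=
  -(o.orient x).rightAngleRotation (grad (𝓡 2) η x)

/-! ### Complex-valued functions `u = u₁ + i u₂`, identified with `(u₁, u₂)` -/

/-- The current `j(u) = (iu) · ∇_g u = (iu)₁ ∇_g u₁ + (iu)₂ ∇_g u₂`. -/
def current (u : M → ℂ) (x : M) : TangentSpace (𝓡 2) x :=
  (Complex.I * u x).re • grad (𝓡 2) (fun y => (u y).re) x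
    + (Complex.I * u x).im • grad (𝓡 2) (fun y => (u y).im) x

/-- The weak Jacobian `⟨J(u), η⟩ = ½ ∫_M ⟨j(u), ∇_g^⊥ η⟩_g dv_g`. -/
def weakJacobian [MeasurableSpace M] (o : SurfaceOrientation M) (u : M → ℂ) (η : M → ℝ) : ℝ :=
  (1 / 2 : ℝ) * ∫ x, (inner ℝ (current u x) (skewGrad o η x) : ℝ) ∂(riemannianVolume M)

variable [IsContMDiffRiemannianBundle (𝓡 2) ∞ Plane (fun x : M => TangentSpace (𝓡 2) x)]

/-- The Laplace-Beltrami operator on complex functions, acting on real and imaginary part. -/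
def laplaceBeltramiC (u : M → ℂ) (x : M) : ℂ :=
  (laplaceBeltrami (𝓡 2) (fun y => (u y).re) x : ℂ)
    + (laplaceBeltrami (𝓡 2) (fun y => (u y).im) x : ℂ) * Complex.I

/-- `⟨∇_g u, ∇_{∇_g u} X⟩_g = ⟨∇_g u₁, ∇_{∇_g u₁} X⟩_g + ⟨∇_g u₂, ∇_{∇_g u₂} X⟩_g` -/
def gradCovGrad (u : M → ℂ) (X : Π x : M, TangentSpace (𝓡 2) x) (x : M) : ℝ :=
  inner ℝ (grad (𝓡 2) (fun y => (u y).re) x)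
      (leviCivita (𝓡 2) M X x (grad (𝓡 2) (fun y => (u y).re) x))
    + inner ℝ (grad (𝓡 2) (fun y => (u y).im) x)
      (leviCivita (𝓡 2) M X x (grad (𝓡 2) (fun y => (u y).im) x))

/-- `u` (a function of the time `t` and the point `x`) is a classical solution on `M × [0, ∞)` of
the Gross-Pitaevskii equation `i u_t - Δ_M u = ε⁻² u (1 - |u|²)` with initial value `u₀`. The time
derivative is required to be continuous in `(t, x)`; so is `Δ_M u` then, by the equation. -/
structure IsGrossPitaevskiiSolution (ε : ℝ) (u₀ : M → ℂ) (u : ℝ → M → ℂ) : Prop where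
  initial : ∀ x, u 0 x = u₀ x
  continuousOn : ContinuousOn (fun p : ℝ × M => u p.1 p.2) (Ici 0 ×ˢ univ)
  differentiableAt_time : ∀ t > 0, ∀ x, DifferentiableAt ℝ (fun s => u s x) t
  continuousOn_deriv_time :
    ContinuousOn (fun p : ℝ × M => deriv (fun s => u s p.2) p.1) (Ioi 0 ×ˢ univ)
  contMDiff_space : ∀ t > 0, ContMDiff (𝓡 2) 𝓘(ℝ, ℂ) 2 (u t)
  equation : ∀ t > 0, ∀ x,
    Complex.I * deriv (fun s => u s x) t - laplaceBeltramiC (u t) x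
      = u t x / (ε : ℂ) ^ 2 * (1 - (‖u t x‖ : ℂ) ^ 2)

end Surface

end GrossPitaevskii

end

noncomputable section

namespace GrossPitaevskii

section ChartField

/-! ### Vector fields with constant coordinates in a chart -/

/-! Put X = ∇^⊥η and Q(v, w) = ∫ (iv)·Xw. Since ⟨j(u), X⟩ = (iu)·Xu (`inner_current`), the weak
Jacobian is Q(u, u)/2. The field X is divergence-free (`divergence_skewGrad`): the rotation is
parallel, so ∇X is a rotated Hessian, and a right-angle rotation composed with a symmetric map has
trace zero. Hence derivatives along X integrate to zero, and Q is symmetric.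

A classical solution need not have a mixed derivative ∂ₜ∇u, so j(u) cannot simply be differentiated
under the integral. Instead, with b = u(t) and d = u(s) - u(t), symmetry gives Q(u(s), u(s)) = Q(b,
b) + 2Q(d, b) + Q(d, d) (`integral_pairing_self_sub`). In Q(d, b) the spatial derivative falls on
the fixed function b, and dominated differentiation gives Q(u_t, u). For Q(d, d), the bound on u_t
on a compact time window gives d = O(|s - t|), and the equation bounds Δu there, so ∫ |∇d|² = -∫
d·Δd = O(|s - t|). By Cauchy-Schwarz and Young, Q(d, d) = O(|s - t|^{3/2}), which has derivative
zero at t.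

The derivative is therefore ∫ (iu_t)·Xu. The equation turns the integrand into Δu·Xu + X(G) with G =
ε⁻²(|u|²/2 - |u|⁴/4). The second term integrates to zero, and the Pohozaev-type identity
`inner_grad_leviCivita` turns the first into -∫ ⟨∇u, ∇_{∇u} X⟩.

All these integrations by parts rest on the divergence theorem for C¹ fields
(`integral_divergence`), obtained from √(det g) div V = ∂ᵢ(√(det g) Vⁱ) in a chart and a partition
of unity. -/

theorem two_le_smooth : (2 : WithTop ℕ∞) ≤ ∞ :=
  WithTop.coe_le_coe.2 (le_top : (2 : ℕ∞) ≤ ⊤)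

/-- A constant vector field on the plane. -/
def constField (a : Plane) (y : Plane) : TangentSpace 𝓘(ℝ, Plane) y := a

theorem contMDiffAt_constField (n : WithTop ℕ∞) (a y : Plane) :
    ContMDiffAt 𝓘(ℝ, Plane) (𝓘(ℝ, Plane).prod 𝓘(ℝ, Plane)) n (T% (constField a)) y := by
  have h : ContMDiffWithinAt 𝓘(ℝ, Plane) (𝓘(ℝ, Plane).prod 𝓘(ℝ, Plane)) n
      (T% (constField a)) univ y :=
    contMDiffWithinAt_vectorSpace_iff_contDiffWithinAt.2 contDiffWithinAt_const
  exact h.contMDiffAt univ_mem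

theorem mlieBracket_constField (a b : Plane) :
    VectorField.mlieBracket 𝓘(ℝ, Plane) (constField a) (constField b) = 0 := by
  rw [← VectorField.mlieBracketWithin_univ, VectorField.mlieBracketWithin_eq_lieBracketWithin]
  ext1 y
  have h : ∀ a : Plane, fderivWithin ℝ (constField a : Plane → Plane) univ y = 0 := fun a =>
    fderivWithin_const_apply _
  change fderivWithin ℝ (constField b : Plane → Plane) univ y (constField a y)
    - fderivWithin ℝ (constField a : Plane → Plane) univ y (constField b y) = 0
  rw [h, h]
  exact sub_self _

variable {M : Type*} [TopologicalSpace M] [ChartedSpace Plane M] [IsManifold (𝓡 2) ∞ M]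

/-- The vector field on the domain of the chart at `c` with constant coordinates `a`. -/
def chartField (c : M) (a : Plane) (x : M) : TangentSpace (𝓡 2) x :=
  (trivializationAt Plane (TangentSpace (𝓡 2)) c).symmL ℝ x a

/-- The coordinates of the vector field `V` in the chart at `c`. -/
def chartCoord (c : M) (V : Π x : M, TangentSpace (𝓡 2) x) (x : M) : Plane :=
  (trivializationAt Plane (TangentSpace (𝓡 2)) c).continuousLinearMapAt ℝ x (V x)

theorem chartField_add (c : M) (a b : Plane) (x : M) :
    chartField c (a + b) x = chartField c a x + chartField c b x :=
  map_add _ _ _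

theorem chartField_smul (c : M) (r : ℝ) (a : Plane) (x : M) :
    chartField c (r • a) x = r • chartField c a x :=
  map_smul _ _ _

theorem chartField_chartCoord {c x : M} (hx : x ∈ (chartAt Plane c).source)
    (V : Π x : M, TangentSpace (𝓡 2) x) : chartField c (chartCoord c V x) x = V x := by
  exact (trivializationAt Plane (TangentSpace (𝓡 2)) c).symmL_continuousLinearMapAt (by simpa) _

theorem chartCoord_chartField {c x : M} (hx : x ∈ (chartAt Plane c).source) (a : Plane) :
    chartCoord c (chartField c a) x = a := by
  exact (trivializationAt Plane (TangentSpace (𝓡 2)) c).continuousLinearMapAt_symmL (by simpa) _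

theorem chartField_eq_sum (c : M) (a : Plane) (x : M) :
    chartField c a x = a 0 • chartField c (EuclideanSpace.single 0 1) x
      + a 1 • chartField c (EuclideanSpace.single 1 1) x := by
  rw [← chartField_smul, ← chartField_smul, ← chartField_add]
  congr 1
  ext i
  fin_cases i <;> simp

theorem exists_chartField_eq {c x : M} (hx : x ∈ (chartAt Plane c).source)
    (v : TangentSpace (𝓡 2) x) : ∃ a, chartField c a x = v :=
  ⟨_, (trivializationAt Plane (TangentSpace (𝓡 2)) c).symmL_continuousLinearMapAt (by simpa) v⟩

theorem chartField_eq_mfderiv {c x : M} (hx : x ∈ (chartAt Plane c).source) (a : Plane) :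
    chartField c a x
      = (mfderiv 𝓘(ℝ, Plane) (𝓡 2) (extChartAt (𝓡 2) c).symm (extChartAt (𝓡 2) c x) a : Plane) := by
  rw [chartField, TangentBundle.symmL_trivializationAt hx, ModelWithCorners.range_eq_univ,
    mfderivWithin_univ]
  rfl

/-- This is the shape of `VectorField.mpullback` along the chart, which reduces brackets of
coordinate fields to brackets in the plane. -/
theorem chartField_eq_inverse {c x : M} (hx : x ∈ (chartAt Plane c).source) (a : Plane) :
    chartField c a x = (mfderiv (𝓡 2) 𝓘(ℝ, Plane) (extChartAt (𝓡 2) c) x).inverse a := by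
  have hinv := isInvertible_mfderiv_extChartAt (I := 𝓡 2) (x := c) (y := x) (by simpa using hx)
  obtain ⟨e, he⟩ := hinv
  have h2 := chartCoord_chartField hx a
  rw [chartCoord, TangentBundle.continuousLinearMapAt_trivializationAt hx] at h2
  rw [← he] at h2 ⊢
  rw [ContinuousLinearMap.inverse_equiv]
  exact (e.symm_apply_eq.2 h2.symm).symm

theorem contMDiffAt_chartField {c x : M} (hx : x ∈ (chartAt Plane c).source) (a : Plane) :
    ContMDiffAt (𝓡 2) ((𝓡 2).prod 𝓘(ℝ, Plane)) ∞ (T% (chartField c a)) x := by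
  rw [(trivializationAt Plane (TangentSpace (𝓡 2)) c).contMDiffAt_section_iff (by simpa)]
  refine (contMDiffAt_const (c := a)).congr_of_eventuallyEq ?_
  filter_upwards [(chartAt Plane c).open_source.mem_nhds hx] with y hy
  have := chartCoord_chartField hy a
  rwa [chartCoord, Trivialization.continuousLinearMapAt_apply,
    Trivialization.linearMapAt_apply, if_pos (by simpa)] at this

theorem contMDiffAt_chartCoord {n : WithTop ℕ∞} (hn : n ≤ ∞) {c x : M}
    (hx : x ∈ (chartAt Plane c).source)
    {V : Π x : M, TangentSpace (𝓡 2) x}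
    (hV : ContMDiffAt (𝓡 2) ((𝓡 2).prod 𝓘(ℝ, Plane)) n (T% V) x) :
    ContMDiffAt (𝓡 2) 𝓘(ℝ, Plane) n (chartCoord c V) x := by
  have : ContMDiffVectorBundle n Plane (TangentSpace (𝓡 2) : M → Type _) (𝓡 2) :=
    ContMDiffVectorBundle.of_le hn
  rw [(trivializationAt Plane (TangentSpace (𝓡 2)) c).contMDiffAt_section_iff (by simpa)] at hV
  refine hV.congr_of_eventuallyEq ?_
  filter_upwards [(chartAt Plane c).open_source.mem_nhds hx] with y hy
  rw [chartCoord, Trivialization.continuousLinearMapAt_apply,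
    Trivialization.linearMapAt_apply, if_pos (by simpa)]

theorem mvfderiv_chartField {c x : M} (hx : x ∈ (chartAt Plane c).source) {f : M → ℝ}
    (hf : MDifferentiableAt (𝓡 2) 𝓘(ℝ, ℝ) f x) (a : Plane) :
    mvfderiv (𝓡 2) f x (chartField c a x)
      = fderiv ℝ (f ∘ (extChartAt (𝓡 2) c).symm) (extChartAt (𝓡 2) c x) a := by
  have hx' : x ∈ (extChartAt (𝓡 2) c).source := by simpa using hx
  have h := mdifferentiableWithinAt_extChartAt_symm (I := 𝓡 2) (x := c)
    ((extChartAt (𝓡 2) c).map_source hx')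
  rw [ModelWithCorners.range_eq_univ, mdifferentiableWithinAt_univ] at h
  have := mvfderiv_comp_apply_of_eq (I := 𝓡 2) (I' := 𝓘(ℝ, Plane)) (g := f) (y := x)
    (extChartAt (𝓡 2) c x) hf h ((extChartAt (𝓡 2) c).left_inv hx') a
  rw [chartField_eq_mfderiv hx]
  rw [mvfderiv, mfderiv_eq_fderiv] at this
  exact this.symm

/-- Pullback commutes with the bracket, and constant fields on the plane commute. -/
theorem mlieBracket_chartField {c x : M} (hx : x ∈ (chartAt Plane c).source) (a b : Plane) :
    VectorField.mlieBracket (𝓡 2) (chartField c a) (chartField c b) x = 0 := by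
  have : CompleteSpace Plane := inferInstance
  have key : ∀ a : Plane, chartField c a =ᶠ[𝓝 x]
      VectorField.mpullback (𝓡 2) 𝓘(ℝ, Plane) (extChartAt (𝓡 2) c) (constField a) := by
    intro a
    filter_upwards [(chartAt Plane c).open_source.mem_nhds hx] with y hy
    exact chartField_eq_inverse hy a
  rw [(key a).mlieBracket_vectorField_eq (key b)]
  have : IsManifold (𝓡 2) (minSmoothness ℝ 2) M :=
    IsManifold.of_le (n := ∞) (by simpa using two_le_smooth)
  have : IsManifold 𝓘(ℝ, Plane) (minSmoothness ℝ 2) Plane :=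
    IsManifold.of_le (n := ∞) (by simpa using two_le_smooth)
  rw [← VectorField.mpullback_mlieBracket (n := ∞)
    ((contMDiffAt_constField 1 a _).mdifferentiableAt one_ne_zero)
    ((contMDiffAt_constField 1 b _).mdifferentiableAt one_ne_zero)
    (contMDiffAt_extChartAt' (by simpa using hx)) (by simpa using two_le_smooth),
    mlieBracket_constField, VectorField.mpullback_zero]
  rfl

/-- The derivative `V f` of a function along a vector field is smooth. -/
theorem contMDiffAt_mvfderiv_apply {n m : WithTop ℕ∞} (hn : n + 1 ≤ m)
    {f : M → ℝ} {x : M}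
    {V : Π x : M, TangentSpace (𝓡 2) x} (hf : ContMDiff (𝓡 2) 𝓘(ℝ, ℝ) m f)
    (hV : ContMDiffAt (𝓡 2) ((𝓡 2).prod 𝓘(ℝ, Plane)) n (T% V) x) :
    ContMDiffAt (𝓡 2) 𝓘(ℝ, ℝ) n (fun y => mvfderiv (𝓡 2) f y (V y)) x := by
  -- The function is the fibre component of the tangent map of `f` composed with the section `V`,
  -- which costs one derivative of `f` and none of `V`.
  have h := (hf.contMDiff_tangentMap hn).contMDiffAt.comp x hV
  have h2 := (contMDiff_snd_tangentBundle_modelSpace ℝ 𝓘(ℝ, ℝ)).contMDiffAt.comp x h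
  exact h2

end ChartField
end GrossPitaevskii
end

noncomputable section

namespace GrossPitaevskii

section Volume

set_option linter.unusedSectionVars false

/-! ### The Riemannian volume in a chart -/

/-- A Gram determinant scales by the squared determinant of the change of frame; this yields the
transformation law of det g. -/
theorem gram_combination {F : Type*} [NormedAddCommGroup F] [InnerProductSpace ℝ F] (v w : F)
    (p q r s : ℝ) :
    inner ℝ (p • v + q • w) (p • v + q • w) * inner ℝ (r • v + s • w) (r • v + s • w)
      - inner ℝ (p • v + q • w) (r • v + s • w) ^ 2
    = (p * s - r * q) ^ 2 * (inner ℝ v v * inner ℝ w w - inner ℝ v w ^ 2) := by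
  simp only [inner_add_left, inner_add_right, inner_smul_left, inner_smul_right,
    real_inner_comm v w, conj_trivial]
  ring

theorem gram_pos {F : Type*} [NormedAddCommGroup F] [InnerProductSpace ℝ F] {v w : F}
    (hv : v ≠ 0) (h : ∀ r : ℝ, w + r • v ≠ 0) :
    0 < inner ℝ v v * inner ℝ w w - inner ℝ v w ^ 2 := by
  have hvv : 0 < inner ℝ v v := real_inner_self_pos.2 hv
  -- This shift makes `w + r • v` orthogonal to `v`, so the Gram determinant is |v|² times the
  -- squared length of that vector.
  have h1 := real_inner_self_pos.2 (h (-(inner ℝ v w / inner ℝ v v)))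
  have h2 : inner ℝ v v * inner ℝ w w - inner ℝ v w ^ 2
      = inner ℝ v v * inner ℝ (w + (-(inner ℝ v w / inner ℝ v v)) • v)
        (w + (-(inner ℝ v w / inner ℝ v v)) • v) := by
    simp only [inner_add_left, inner_add_right, inner_smul_left, inner_smul_right,
      real_inner_comm v w, conj_trivial]
    field_simp
    ring
  rw [h2]
  positivity

theorem det_plane (A : Plane →L[ℝ] Plane) :
    A.det = A (EuclideanSpace.single 0 1) 0 * A (EuclideanSpace.single 1 1) 1
      - A (EuclideanSpace.single 1 1) 0 * A (EuclideanSpace.single 0 1) 1 := by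
  rw [ContinuousLinearMap.det, ← LinearMap.det_toMatrix (EuclideanSpace.basisFun (Fin 2) ℝ).toBasis,
    Matrix.det_fin_two]
  simp [LinearMap.toMatrix_apply]

variable {M : Type*} [TopologicalSpace M] [ChartedSpace Plane M] [IsManifold (𝓡 2) ∞ M]
  [RiemannianBundle (fun x : M => TangentSpace (𝓡 2) x)]

/-- The metric coefficients `g_ij` of the chart at `c`. -/
def metricCoeff (c : M) (i j : Fin 2) (x : M) : ℝ :=
  inner ℝ (chartField c (EuclideanSpace.single i 1) x) (chartField c (EuclideanSpace.single j 1) x)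

/-- The determinant of `(g_ij)` in the chart at `c`. -/
def gramDet (c : M) (x : M) : ℝ :=
  metricCoeff c 0 0 x * metricCoeff c 1 1 x - metricCoeff c 0 1 x ^ 2

/-- The density `√(det g)` of the volume in the chart at `c`. -/
def volDensity (c : M) (x : M) : ℝ := Real.sqrt (gramDet c x)

theorem coordVec_eq {c : M} {y : Plane} (hy : y ∈ (extChartAt (𝓡 2) c).target) (i : Fin 2) :
    coordVec c y i
      = chartField c (EuclideanSpace.single i 1) ((extChartAt (𝓡 2) c).symm y) := by
  rw [chartField_eq_mfderiv (by simpa using (extChartAt (𝓡 2) c).map_target hy),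
    (extChartAt (𝓡 2) c).right_inv hy]
  rfl

theorem det_metricMatrix {c : M} {y : Plane} (hy : y ∈ (extChartAt (𝓡 2) c).target) :
    (metricMatrix c y).det = gramDet c ((extChartAt (𝓡 2) c).symm y) := by
  simp only [metricMatrix, Matrix.det_fin_two, Matrix.of_apply, gramDet, metricCoeff,
    coordVec_eq hy]
  rw [sq]
  congr 2
  exact real_inner_comm _ _

theorem chartField_ne_zero {c x : M} (hx : x ∈ (chartAt Plane c).source) {a : Plane}
    (ha : a ≠ 0) : chartField c a x ≠ 0 := by
  intro h
  apply ha
  rw [← chartCoord_chartField hx a, chartCoord, h, map_zero]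

theorem gramDet_pos {c x : M} (hx : x ∈ (chartAt Plane c).source) : 0 < gramDet c x := by
  refine gram_pos (chartField_ne_zero hx (by simp)) fun r => ?_
  rw [← chartField_smul, ← chartField_add]
  refine chartField_ne_zero hx fun h => ?_
  simpa using congrArg (fun a : Plane => a 1) h

/-- Chain rule for the transition map: its derivative converts coordinates in one chart into
coordinates in the other. -/
theorem chartField_change {c c' x : M} (hx : x ∈ (chartAt Plane c).source)
    (hx' : x ∈ (chartAt Plane c').source) (a : Plane) :
    chartField c a x = chartField c'
      (fderiv ℝ (extChartAt (𝓡 2) c' ∘ (extChartAt (𝓡 2) c).symm) (extChartAt (𝓡 2) c x) a) x := by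
  have hxs : x ∈ (extChartAt (𝓡 2) c).source := by simpa using hx
  have h := mdifferentiableWithinAt_extChartAt_symm (I := 𝓡 2) (x := c)
    ((extChartAt (𝓡 2) c).map_source hxs)
  rw [ModelWithCorners.range_eq_univ, mdifferentiableWithinAt_univ] at h
  have h2 := mfderiv_comp_apply_of_eq (I := 𝓘(ℝ, Plane)) (I' := 𝓡 2) (I'' := 𝓘(ℝ, Plane))
    (g := extChartAt (𝓡 2) c') (y := x) (extChartAt (𝓡 2) c x)
    (mdifferentiableAt_extChartAt (by simpa using hx')) h ((extChartAt (𝓡 2) c).left_inv hxs) a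
  rw [mfderiv_eq_fderiv] at h2
  rw [← chartField_chartCoord hx' (chartField c a), chartCoord,
    TangentBundle.continuousLinearMapAt_trivializationAt hx', chartField_eq_mfderiv hx]
  exact congrArg (fun b => chartField c' b x) h2.symm

theorem gramDet_change {c c' x : M} (hx : x ∈ (chartAt Plane c).source)
    (hx' : x ∈ (chartAt Plane c').source) :
    gramDet c x = (fderiv ℝ (extChartAt (𝓡 2) c' ∘ (extChartAt (𝓡 2) c).symm)
      (extChartAt (𝓡 2) c x)).det ^ 2 * gramDet c' x := by
  simp only [gramDet, metricCoeff]
  rw [chartField_change hx hx', chartField_change hx hx', det_plane, chartField_eq_sum c',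
    chartField_eq_sum c' (fderiv ℝ _ _ (EuclideanSpace.single 1 1)), gram_combination]

/-- The factor is the Jacobian of the transition map, exactly what the change of variables formula
produces. -/
theorem volDensity_change {c c' x : M} (hx : x ∈ (chartAt Plane c).source)
    (hx' : x ∈ (chartAt Plane c').source) :
    volDensity c x = |(fderiv ℝ (extChartAt (𝓡 2) c' ∘ (extChartAt (𝓡 2) c).symm)
      (extChartAt (𝓡 2) c x)).det| * volDensity c' x := by
  rw [volDensity, gramDet_change hx hx', Real.sqrt_mul (sq_nonneg _), Real.sqrt_sq_eq_abs,
    volDensity]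

/-! ### Smoothness of the metric coefficients and of the density. -/

section Regularity

variable [IsContMDiffRiemannianBundle (𝓡 2) ∞ Plane (fun x : M => TangentSpace (𝓡 2) x)]

theorem contMDiffAt_inner {n : WithTop ℕ∞} (hn : n ≤ ∞) {V W : Π x : M, TangentSpace (𝓡 2) x}
    {x : M} (hV : ContMDiffAt (𝓡 2) ((𝓡 2).prod 𝓘(ℝ, Plane)) n (T% V) x)
    (hW : ContMDiffAt (𝓡 2) ((𝓡 2).prod 𝓘(ℝ, Plane)) n (T% W) x) :
    ContMDiffAt (𝓡 2) 𝓘(ℝ, ℝ) n (fun y => (inner ℝ (V y) (W y) : ℝ)) x := by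
  have : IsContMDiffRiemannianBundle (𝓡 2) n Plane (fun x : M => TangentSpace (𝓡 2) x) :=
    IsContMDiffRiemannianBundle.of_le hn
  have : IsManifold (𝓡 2) n M := IsManifold.of_le hn
  have : ContMDiffVectorBundle n Plane (TangentSpace (𝓡 2) : M → Type _) (𝓡 2) :=
    ContMDiffVectorBundle.of_le hn
  exact ContMDiffAt.inner_bundle (E := fun x : M => TangentSpace (𝓡 2) x) hV hW

theorem contMDiffAt_metricCoeff {c x : M} (hx : x ∈ (chartAt Plane c).source) (i j : Fin 2) :
    ContMDiffAt (𝓡 2) 𝓘(ℝ, ℝ) ∞ (metricCoeff c i j) x :=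
  contMDiffAt_inner le_rfl (contMDiffAt_chartField hx _) (contMDiffAt_chartField hx _)

theorem contMDiffAt_gramDet {c x : M} (hx : x ∈ (chartAt Plane c).source) :
    ContMDiffAt (𝓡 2) 𝓘(ℝ, ℝ) ∞ (gramDet c) x :=
  ((contMDiffAt_metricCoeff hx 0 0).mul (contMDiffAt_metricCoeff hx 1 1)).sub
    ((contMDiffAt_metricCoeff hx 0 1).pow 2)

theorem contMDiffAt_volDensity {c x : M} (hx : x ∈ (chartAt Plane c).source) :
    ContMDiffAt (𝓡 2) 𝓘(ℝ, ℝ) ∞ (volDensity c) x :=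
  ContMDiffAt.comp (I' := 𝓘(ℝ, ℝ)) x (Real.contDiffAt_sqrt (gramDet_pos hx).ne').contMDiffAt
    (contMDiffAt_gramDet hx)

theorem continuousOn_volDensity_symm (c : M) :
    ContinuousOn (fun y => volDensity c ((extChartAt (𝓡 2) c).symm y))
      (extChartAt (𝓡 2) c).target := by
  refine ContinuousOn.comp (g := volDensity c) (t := (extChartAt (𝓡 2) c).source) (fun x hx => ?_)
    (continuousOn_extChartAt_symm c) (extChartAt (𝓡 2) c).mapsTo_symm
  exact (contMDiffAt_volDensity (by simpa using hx)).continuousAt.continuousWithinAt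

end Regularity

/-! ### Chart volumes and how they glue. -/

variable [MeasurableSpace M] [BorelSpace M]

theorem aemeasurable_extChartAt_symm (c : M) :
    AEMeasurable (extChartAt (𝓡 2) c).symm
      ((volume : Measure Plane).restrict (extChartAt (𝓡 2) c).target) :=
  (continuousOn_extChartAt_symm c).aemeasurable (isOpen_extChartAt_target c).measurableSet

theorem measurableSet_chart_preimage (c : M) {S : Set M} (hS : MeasurableSet S) :
    MeasurableSet ((extChartAt (𝓡 2) c).target ∩ (extChartAt (𝓡 2) c).symm ⁻¹' S) := by
  have h1 := (continuousOn_extChartAt_symm (I := 𝓡 2) c).domRestrict.measurable hS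
  have h2 := (isOpen_extChartAt_target (I := 𝓡 2) c).measurableSet.subtype_image h1
  rwa [show (extChartAt (𝓡 2) c).target.domRestrict (extChartAt (𝓡 2) c).symm ⁻¹' S
    = Subtype.val ⁻¹' ((extChartAt (𝓡 2) c).symm ⁻¹' S) from rfl,
    Subtype.image_preimage_coe] at h2

theorem chartVolume_apply (c : M) {S : Set M} (hS : MeasurableSet S) :
    chartVolume c S = ∫⁻ y in (extChartAt (𝓡 2) c).target ∩ (extChartAt (𝓡 2) c).symm ⁻¹' S,
      ENNReal.ofReal (volDensity c ((extChartAt (𝓡 2) c).symm y)) := by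
  have hT := (isOpen_extChartAt_target (I := 𝓡 2) c).measurableSet
  rw [chartVolume, Measure.map_apply_of_aemeasurable _ hS, withDensity_apply',
    Measure.restrict_restrict' hT, inter_comm]
  · refine setLIntegral_congr_fun (measurableSet_chart_preimage c hS) fun y hy => ?_
    simp only [volDensity, det_metricMatrix hy.1]
  · exact (aemeasurable_extChartAt_symm c).mono_ac (withDensity_absolutelyContinuous _ _)

theorem chartVolume_inter_source (c : M) {S : Set M} (hS : MeasurableSet S) :
    chartVolume c (S ∩ (chartAt Plane c).source) = chartVolume c S := by
  rw [chartVolume_apply c hS,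
    chartVolume_apply c (hS.inter (chartAt Plane c).open_source.measurableSet)]
  congr 2
  ext y
  have := fun hy => (extChartAt (𝓡 2) c).map_target (x := y) hy
  simp only [extChartAt_source] at this
  simp only [mem_inter_iff, mem_preimage]
  tauto

/-- Change of variables by the transition map, whose Jacobian is absorbed by `volDensity_change`. -/
theorem chartVolume_eq_of_subset {c c' : M} {S : Set M} (hS : MeasurableSet S)
    (h : S ⊆ (chartAt Plane c).source) (h' : S ⊆ (chartAt Plane c').source) :
    chartVolume c' S = chartVolume c S := by
  have hx : ∀ y ∈ (extChartAt (𝓡 2) c).target ∩ (extChartAt (𝓡 2) c).symm ⁻¹' S,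
      y ∈ (extChartAt (𝓡 2) c).target ∧ (extChartAt (𝓡 2) c).symm y ∈ (chartAt Plane c).source ∧
        (extChartAt (𝓡 2) c).symm y ∈ (chartAt Plane c').source :=
    fun y hy => ⟨hy.1, h hy.2, h' hy.2⟩
  have himage : (extChartAt (𝓡 2) c').target ∩ (extChartAt (𝓡 2) c').symm ⁻¹' S
      = (extChartAt (𝓡 2) c' ∘ (extChartAt (𝓡 2) c).symm) ''
        ((extChartAt (𝓡 2) c).target ∩ (extChartAt (𝓡 2) c).symm ⁻¹' S) := by
    ext z
    constructor
    · rintro ⟨hz, hzS⟩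
      have hs := h hzS
      rw [← extChartAt_source (𝓡 2)] at hs
      refine ⟨extChartAt (𝓡 2) c ((extChartAt (𝓡 2) c').symm z),
        ⟨(extChartAt (𝓡 2) c).map_source hs, ?_⟩, ?_⟩
      · rwa [mem_preimage, (extChartAt (𝓡 2) c).left_inv hs]
      · rw [Function.comp_apply, (extChartAt (𝓡 2) c).left_inv hs,
          (extChartAt (𝓡 2) c').right_inv hz]
    · rintro ⟨y, ⟨hy, hyS⟩, rfl⟩
      have hs := h' hyS
      rw [← extChartAt_source (𝓡 2)] at hs
      refine ⟨(extChartAt (𝓡 2) c').map_source hs, ?_⟩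
      rwa [mem_preimage, Function.comp_apply, (extChartAt (𝓡 2) c').left_inv hs]
  rw [chartVolume_apply c hS, chartVolume_apply c' hS, himage,
    lintegral_image_eq_lintegral_abs_det_fderiv_mul volume (measurableSet_chart_preimage c hS)
      (f' := fderiv ℝ (extChartAt (𝓡 2) c' ∘ (extChartAt (𝓡 2) c).symm))]
  · refine setLIntegral_congr_fun (measurableSet_chart_preimage c hS) fun y hy => ?_
    obtain ⟨h1, h2, h3⟩ := hx y hy
    simp only [Function.comp]
    rw [(extChartAt (𝓡 2) c').left_inv (by simpa using h3), volDensity_change h2 h3,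
      (extChartAt (𝓡 2) c).right_inv h1, ENNReal.ofReal_mul (abs_nonneg _)]
  · intro y hy
    obtain ⟨h1, h2, h3⟩ := hx y hy
    have hd := mdifferentiableWithinAt_extChartAt_symm (I := 𝓡 2) (x := c) h1
    rw [ModelWithCorners.range_eq_univ, mdifferentiableWithinAt_univ] at hd
    have h4 := (mdifferentiableAt_extChartAt (I := 𝓡 2) (x := c') h3).comp y hd
    exact (mdifferentiableAt_iff_differentiableAt.1 h4).hasFDerivAt.hasFDerivWithinAt
  · intro y hy z hz hyz
    obtain ⟨h1, h2, h3⟩ := hx y hy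
    obtain ⟨h1', h2', h3'⟩ := hx z hz
    have h5 := (extChartAt (𝓡 2) c').injOn (by simpa using h3) (by simpa using h3') hyz
    exact (extChartAt (𝓡 2) c).symm.injOn h1 h1' h5

/-- On the domain of a chart, the Riemannian volume is `√(det g) dx₁ dx₂`. -/
theorem riemannianVolume_restrict (c : M) :
    (riemannianVolume M).restrict (chartAt Plane c).source = chartVolume c := by
  have hsrc : ∀ c : M, MeasurableSet (chartAt Plane c).source :=
    fun c => (chartAt Plane c).open_source.measurableSet
  have hle : ∀ c : M, chartVolume c ≤ riemannianVolume M := fun c => le_iSup chartVolume c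
  have hself : (chartVolume c).restrict (chartAt Plane c).source = chartVolume c := by
    ext S hS
    rw [Measure.restrict_apply hS, chartVolume_inter_source c hS]
  -- On the domain of the chart at `c`, a chart volume is only the part of `chartVolume c` lying
  -- over the overlap.
  have hloc : ∀ c' : M, (chartVolume c').restrict (chartAt Plane c).source ≤ chartVolume c := by
    intro c'
    refine Measure.le_iff.2 fun S hS => ?_
    rw [Measure.restrict_apply hS, ← chartVolume_inter_source c' (hS.inter (hsrc c)),
      chartVolume_eq_of_subset (c := c) ((hS.inter (hsrc c)).inter (hsrc c'))
        (fun x hx => hx.1.2) (fun x hx => hx.2)]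
    exact measure_mono fun x hx => hx.1.1
  refine le_antisymm ?_ ?_
  -- A supremum of measures is controlled by exhibiting one measure above all of them. This one
  -- exceeds `chartVolume c` only off the chart domain, and the excess disappears on restriction.
  · have h : riemannianVolume M
        ≤ chartVolume c + (riemannianVolume M).restrict (chartAt Plane c).sourceᶜ := by
      refine iSup_le fun c' => ?_
      rw [← Measure.restrict_add_restrict_compl (μ := chartVolume c') (hsrc c)]
      exact add_le_add (hloc c') (Measure.restrict_mono le_rfl (hle c'))
    refine (Measure.restrict_mono le_rfl h).trans ?_
    rw [Measure.restrict_add, hself, Measure.restrict_restrict (hsrc c)]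
    simp
  · rw [← hself]
    exact Measure.restrict_mono le_rfl (hle c)

variable [IsContMDiffRiemannianBundle (𝓡 2) ∞ Plane (fun x : M => TangentSpace (𝓡 2) x)]

/-- Near `c` the density is continuous, hence below its value at `c` plus one, and a coordinate ball
has finite area. -/
instance isLocallyFiniteMeasure_riemannianVolume :
    IsLocallyFiniteMeasure (riemannianVolume M) where
  finiteAtNhds c := by
    set φ := extChartAt (𝓡 2) c
    have hc : φ c ∈ φ.target := mem_extChartAt_target c
    have hcont : ContinuousAt (fun y => volDensity c (φ.symm y)) (φ c) :=
      (continuousOn_volDensity_symm c).continuousAt ((isOpen_extChartAt_target c).mem_nhds hc)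
    set K := volDensity c (φ.symm (φ c)) + 1
    have hev : ∀ᶠ y in 𝓝 (φ c), volDensity c (φ.symm y) < K ∧ y ∈ Metric.ball (φ c) 1 :=
      (hcont.eventually_lt_const (by simp [K])).and (Metric.ball_mem_nhds _ one_pos)
    obtain ⟨U, hU, hUo, hcU⟩ := eventually_nhds_iff.1 hev
    refine ⟨φ.source ∩ φ ⁻¹' U, ?_, ?_⟩
    · exact inter_mem (extChartAt_source_mem_nhds c)
        ((continuousAt_extChartAt c).preimage_mem_nhds (hUo.mem_nhds hcU))
    · have hopen : IsOpen (φ.source ∩ φ ⁻¹' U) :=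
        (continuousOn_extChartAt c).isOpen_inter_preimage (isOpen_extChartAt_source c) hUo
      have h1 : riemannianVolume M (φ.source ∩ φ ⁻¹' U) = chartVolume c (φ.source ∩ φ ⁻¹' U) := by
        have hsub : φ.source ∩ φ ⁻¹' U ⊆ (chartAt Plane c).source := fun x hx => by
          simpa [φ] using hx.1
        rw [← riemannianVolume_restrict, Measure.restrict_apply hopen.measurableSet,
          inter_eq_left.2 hsub]
      rw [h1, chartVolume_apply c hopen.measurableSet]
      have hsub : φ.target ∩ φ.symm ⁻¹' (φ.source ∩ φ ⁻¹' U) ⊆ U := by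
        rintro y ⟨hy, -, hyU⟩
        rwa [mem_preimage, φ.right_inv hy] at hyU
      calc _ ≤ ∫⁻ y in U, ENNReal.ofReal K := by
            refine (lintegral_mono_set hsub).trans (setLIntegral_mono measurable_const fun y hy => ?_)
            exact ENNReal.ofReal_le_ofReal (hU y hy).1.le
        _ < ⊤ := by
            rw [setLIntegral_const]
            refine ENNReal.mul_lt_top ENNReal.ofReal_lt_top ?_
            exact (measure_mono fun y hy => (hU y hy).2).trans_lt Metric.isBounded_ball.measure_lt_top

/-- Integration over the domain of a chart, in coordinates. -/
theorem integral_riemannianVolume_of_support {c : M} {F : M → ℝ} (hF : Continuous F)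
    (hsupp : ∀ x ∉ (chartAt Plane c).source, F x = 0) :
    ∫ x, F x ∂(riemannianVolume M) = ∫ y in (extChartAt (𝓡 2) c).target,
      volDensity c ((extChartAt (𝓡 2) c).symm y) * F ((extChartAt (𝓡 2) c).symm y) := by
  have hT := (isOpen_extChartAt_target (I := 𝓡 2) c).measurableSet
  have hae : (fun y => ENNReal.ofReal (Real.sqrt (metricMatrix c y).det))
      =ᵐ[(volume : Measure Plane).restrict (extChartAt (𝓡 2) c).target]
      fun y => ENNReal.ofReal (volDensity c ((extChartAt (𝓡 2) c).symm y)) := by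
    filter_upwards [ae_restrict_mem hT] with y hy
    rw [det_metricMatrix hy, volDensity]
  rw [← setIntegral_eq_integral_of_forall_compl_eq_zero hsupp, riemannianVolume_restrict,
    chartVolume, withDensity_congr_ae hae, integral_map, integral_withDensity_eq_integral_toReal_smul₀]
  · refine setIntegral_congr_fun hT fun y _ => ?_
    simp only [smul_eq_mul]
    rw [ENNReal.toReal_ofReal (r := volDensity c _) (Real.sqrt_nonneg _)]
  · exact ((continuousOn_volDensity_symm c).aemeasurable hT).ennreal_ofReal
  · simp
  · exact (aemeasurable_extChartAt_symm c).mono_ac (withDensity_absolutelyContinuous _ _)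
  · exact hF.aestronglyMeasurable

end Volume
end GrossPitaevskii
end

noncomputable section

namespace GrossPitaevskii

section Divergence

set_option linter.unusedSectionVars false

/-! ### The divergence theorem -/

/-- Derivative at s = 0 of Gram((1 + sT)b) = det(1 + sT)² Gram(b). It serves both to differentiate
det g and to compute traces without an orthonormal basis. -/
theorem trace_mul_gram {F : Type*} [NormedAddCommGroup F] [InnerProductSpace ℝ F]
    (b : Module.Basis (Fin 2) ℝ F) (T : F →ₗ[ℝ] F) :
    2 * inner ℝ (T (b 0)) (b 0) * inner ℝ (b 1) (b 1)
      + inner ℝ (b 0) (b 0) * (2 * inner ℝ (T (b 1)) (b 1))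
      - 2 * inner ℝ (b 0) (b 1) * (inner ℝ (T (b 0)) (b 1) + inner ℝ (b 0) (T (b 1)))
    = 2 * LinearMap.trace ℝ F T * (inner ℝ (b 0) (b 0) * inner ℝ (b 1) (b 1)
      - inner ℝ (b 0) (b 1) ^ 2) := by
  have h0 := b.sum_repr (T (b 0))
  have h1 := b.sum_repr (T (b 1))
  rw [Fin.sum_univ_two] at h0 h1
  rw [LinearMap.trace_eq_matrix_trace ℝ b, Matrix.trace_fin_two, LinearMap.toMatrix_apply,
    LinearMap.toMatrix_apply]
  generalize b.repr (T (b 0)) = p at *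
  generalize b.repr (T (b 1)) = q at *
  rw [← h0, ← h1]
  simp only [inner_add_left, inner_add_right, inner_smul_left, inner_smul_right,
    real_inner_comm (b 0) (b 1), conj_trivial]
  ring

variable {M : Type*} [TopologicalSpace M] [ChartedSpace Plane M] [IsManifold (𝓡 2) ∞ M]

/-- The basis of the tangent plane given by the coordinate fields of the chart at `c`. -/
def chartBasis {c x : M} (hx : x ∈ (chartAt Plane c).source) :
    Module.Basis (Fin 2) ℝ (TangentSpace (𝓡 2) x) :=
  (EuclideanSpace.basisFun (Fin 2) ℝ).toBasis.map
    ((trivializationAt Plane (TangentSpace (𝓡 2)) c).linearEquivAt ℝ x (by simpa)).symm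

theorem chartBasis_apply {c x : M} (hx : x ∈ (chartAt Plane c).source) (i : Fin 2) :
    chartBasis hx i = chartField c (EuclideanSpace.single i 1) x := by
  rw [chartField, Trivialization.symmL_apply _ (by simpa)]
  simp [chartBasis]

variable [RiemannianBundle (fun x : M => TangentSpace (𝓡 2) x)]
  [IsContMDiffRiemannianBundle (𝓡 2) ∞ Plane (fun x : M => TangentSpace (𝓡 2) x)]

/-- A vector field which is `C^n` at `x`. -/
abbrev FieldAt (n : WithTop ℕ∞) (V : Π x : M, TangentSpace (𝓡 2) x) (x : M) : Prop :=
  ContMDiffAt (𝓡 2) ((𝓡 2).prod 𝓘(ℝ, Plane)) n (T% V) x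

/-- A vector field which is differentiable at `x`. -/
abbrev DiffFieldAt (V : Π x : M, TangentSpace (𝓡 2) x) (x : M) : Prop :=
  MDifferentiableAt (𝓡 2) ((𝓡 2).prod 𝓘(ℝ, Plane)) (T% V) x

theorem diffFieldAt_chartField {c x : M} (hx : x ∈ (chartAt Plane c).source) (a : Plane) :
    DiffFieldAt (chartField c a) x :=
  (contMDiffAt_chartField hx a).mdifferentiableAt (by simp)

theorem leviCivita_add {V W : Π x : M, TangentSpace (𝓡 2) x} {x : M}
    (hV : DiffFieldAt V x) (hW : DiffFieldAt W x) :
    leviCivita (𝓡 2) M (V + W) x = leviCivita (𝓡 2) M V x + leviCivita (𝓡 2) M W x :=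
  (leviCivita (𝓡 2) M).isCovariantDerivativeOnUniv.add hV hW

theorem leviCivita_smul {V : Π x : M, TangentSpace (𝓡 2) x} {f : M → ℝ} {x : M}
    (hf : MDifferentiableAt (𝓡 2) 𝓘(ℝ, ℝ) f x) (hV : DiffFieldAt V x) :
    leviCivita (𝓡 2) M (f • V) x
      = f x • leviCivita (𝓡 2) M V x + (mvfderiv (𝓡 2) f x).smulRight (V x) :=
  (leviCivita (𝓡 2) M).isCovariantDerivativeOnUniv.leibniz hV hf

theorem leviCivita_congr {V W : Π x : M, TangentSpace (𝓡 2) x} {x : M}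
    (hV : DiffFieldAt V x) (h : V =ᶠ[𝓝 x] W) :
    leviCivita (𝓡 2) M V x = leviCivita (𝓡 2) M W x :=
  (leviCivita (𝓡 2) M).isCovariantDerivativeOnUniv.congr_of_eventuallyEq hV
    (hV.congr_of_eventuallyEq (h.mono fun y hy => by simp [hy])) univ_mem h

theorem divergence_add {V W : Π x : M, TangentSpace (𝓡 2) x} {x : M}
    (hV : DiffFieldAt V x) (hW : DiffFieldAt W x) :
    divergence (𝓡 2) (V + W) x = divergence (𝓡 2) V x + divergence (𝓡 2) W x := by
  rw [divergence, leviCivita_add hV hW]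
  exact map_add _ _ _

theorem divergence_smul {V : Π x : M, TangentSpace (𝓡 2) x} {f : M → ℝ} {x : M}
    (hf : MDifferentiableAt (𝓡 2) 𝓘(ℝ, ℝ) f x) (hV : DiffFieldAt V x) :
    divergence (𝓡 2) (f • V) x = f x * divergence (𝓡 2) V x + mvfderiv (𝓡 2) f x (V x) := by
  rw [divergence, leviCivita_smul hf hV]
  have h : ((f x • leviCivita (𝓡 2) M V x + (mvfderiv (𝓡 2) f x).smulRight (V x) :
        TangentSpace (𝓡 2) x →L[ℝ] TangentSpace (𝓡 2) x) :
        TangentSpace (𝓡 2) x →ₗ[ℝ] TangentSpace (𝓡 2) x)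
      = f x • (leviCivita (𝓡 2) M V x : TangentSpace (𝓡 2) x →ₗ[ℝ] TangentSpace (𝓡 2) x)
        + LinearMap.smulRight ((mvfderiv (𝓡 2) f x : TangentSpace (𝓡 2) x →L[ℝ] ℝ) :
          TangentSpace (𝓡 2) x →ₗ[ℝ] ℝ) (V x) := rfl
  rw [h, map_add, map_smul, LinearMap.trace_smulRight]
  rfl

theorem divergence_congr {V W : Π x : M, TangentSpace (𝓡 2) x} {x : M}
    (hV : DiffFieldAt V x) (h : V =ᶠ[𝓝 x] W) :
    divergence (𝓡 2) V x = divergence (𝓡 2) W x := by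
  rw [divergence, leviCivita_congr hV h, divergence]

/-! ### The divergence in coordinates. -/

theorem leviCivita_chartField_comm {c x : M} (hx : x ∈ (chartAt Plane c).source) (a b : Plane) :
    leviCivita (𝓡 2) M (chartField c a) x (chartField c b x)
      = leviCivita (𝓡 2) M (chartField c b) x (chartField c a x) := by
  have h := leviCivita_torsion (diffFieldAt_chartField hx b) (diffFieldAt_chartField hx a)
  rwa [mlieBracket_chartField hx, sub_eq_zero] at h

/-- Metric compatibility gives ∇_{e_a} e_i; swapping the fields by vanishing torsion leaves the
single endomorphism v ↦ ∇_v e_a, whose trace is div e_a. -/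
theorem mvfderiv_metricCoeff {c x : M} (hx : x ∈ (chartAt Plane c).source) (a : Plane)
    (i j : Fin 2) :
    mvfderiv (𝓡 2) (metricCoeff c i j) x (chartField c a x)
      = inner ℝ (leviCivita (𝓡 2) M (chartField c a) x (chartBasis hx i)) (chartBasis hx j)
        + inner ℝ (chartBasis hx i) (leviCivita (𝓡 2) M (chartField c a) x (chartBasis hx j)) := by
  have h := leviCivita_isMetricCompatible (diffFieldAt_chartField hx a)
    (diffFieldAt_chartField hx (EuclideanSpace.single i 1))
    (diffFieldAt_chartField hx (EuclideanSpace.single j 1))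
  rw [leviCivita_chartField_comm hx, leviCivita_chartField_comm hx _ a] at h
  simpa only [chartBasis_apply] using! h

theorem mdifferentiableAt_metricCoeff {c x : M} (hx : x ∈ (chartAt Plane c).source)
    (i j : Fin 2) : MDifferentiableAt (𝓡 2) 𝓘(ℝ, ℝ) (metricCoeff c i j) x :=
  (contMDiffAt_metricCoeff hx i j).mdifferentiableAt (by simp)

/-- Jacobi's formula: `trace_mul_gram` applied to T = ∇e_a, whose left side is the product-rule
derivative of the Gram determinant. -/
theorem mvfderiv_gramDet {c x : M} (hx : x ∈ (chartAt Plane c).source) (a : Plane) :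
    mvfderiv (𝓡 2) (gramDet c) x (chartField c a x)
      = 2 * divergence (𝓡 2) (chartField c a) x * gramDet c x := by
  have h0 := mdifferentiableAt_metricCoeff hx 0 0
  have h1 := mdifferentiableAt_metricCoeff hx 1 1
  have h2 := mdifferentiableAt_metricCoeff hx 0 1
  have hg : gramDet c = metricCoeff c 0 0 * metricCoeff c 1 1 - metricCoeff c 0 1 * metricCoeff c 0 1 := by
    funext y
    simp [gramDet, sq]
  have key := trace_mul_gram (chartBasis hx)
    (leviCivita (𝓡 2) M (chartField c a) x : TangentSpace (𝓡 2) x →ₗ[ℝ] TangentSpace (𝓡 2) x)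
  have hd : mvfderiv (𝓡 2) (gramDet c) x (chartField c a x)
      = metricCoeff c 0 0 x * mvfderiv (𝓡 2) (metricCoeff c 1 1) x (chartField c a x)
        + metricCoeff c 1 1 x * mvfderiv (𝓡 2) (metricCoeff c 0 0) x (chartField c a x)
        - 2 * metricCoeff c 0 1 x * mvfderiv (𝓡 2) (metricCoeff c 0 1) x (chartField c a x) := by
    rw [hg, mvfderiv_sub (h0.mul h1) (h2.mul h2), mvfderiv_mul h0 h1, mvfderiv_mul h2 h2]
    simp
    ring
  rw [hd, mvfderiv_metricCoeff hx, mvfderiv_metricCoeff hx, mvfderiv_metricCoeff hx]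
  have hm : ∀ i j, metricCoeff c i j x = inner ℝ (chartBasis hx i) (chartBasis hx j) := by
    intro i j
    rw [metricCoeff, chartBasis_apply, chartBasis_apply]
  rw [gramDet, hm, hm, hm, divergence, ← key]
  have hc : ∀ i, inner ℝ (chartBasis hx i) (leviCivita (𝓡 2) M (chartField c a) x (chartBasis hx i))
      = inner ℝ (leviCivita (𝓡 2) M (chartField c a) x (chartBasis hx i)) (chartBasis hx i) :=
    fun i => real_inner_comm _ _
  rw [hc, hc]
  simp only [ContinuousLinearMap.coe_coe]
  ring

theorem mdifferentiableAt_volDensity {c x : M} (hx : x ∈ (chartAt Plane c).source) :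
    MDifferentiableAt (𝓡 2) 𝓘(ℝ, ℝ) (volDensity c) x :=
  (contMDiffAt_volDensity hx).mdifferentiableAt (by simp)

theorem volDensity_pos {c x : M} (hx : x ∈ (chartAt Plane c).source) : 0 < volDensity c x :=
  Real.sqrt_pos.2 (gramDet_pos hx)

/-- Half of the formula for det g, read off from det g = (√(det g))² and division by the positive
density. -/
theorem mvfderiv_volDensity {c x : M} (hx : x ∈ (chartAt Plane c).source) (a : Plane) :
    mvfderiv (𝓡 2) (volDensity c) x (chartField c a x)
      = volDensity c x * divergence (𝓡 2) (chartField c a) x := by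
  have h0 := mdifferentiableAt_volDensity hx
  have hG := mvfderiv_gramDet hx a
  have hev : gramDet c =ᶠ[𝓝 x] fun y => volDensity c y * volDensity c y := by
    filter_upwards [(chartAt Plane c).open_source.mem_nhds hx] with y hy
    exact (Real.mul_self_sqrt (gramDet_pos hy).le).symm
  have hd : mvfderiv (𝓡 2) (gramDet c) x (chartField c a x)
      = 2 * (volDensity c x * mvfderiv (𝓡 2) (volDensity c) x (chartField c a x)) := by
    have : mvfderiv (𝓡 2) (gramDet c) x
        = mvfderiv (𝓡 2) (fun y => volDensity c y * volDensity c y) x := by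
      simp only [mvfderiv, hev.mfderiv_eq]
      rw [hev.eq_of_nhds]
    rw [this, mvfderiv_fun_mul h0 h0]
    simp
    ring
  have hpos := volDensity_pos hx
  rw [hd, hev.eq_of_nhds] at hG
  have : volDensity c x * (mvfderiv (𝓡 2) (volDensity c) x (chartField c a x)
      - volDensity c x * divergence (𝓡 2) (chartField c a) x) = 0 := by linear_combination hG / 2
  exact sub_eq_zero.1 ((mul_eq_zero.1 this).resolve_left hpos.ne')

theorem mdifferentiableAt_chartCoord {c x : M} (hx : x ∈ (chartAt Plane c).source)
    {V : Π x : M, TangentSpace (𝓡 2) x} (hV : FieldAt 1 V x) (i : Fin 2) :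
    ContMDiffAt (𝓡 2) 𝓘(ℝ, ℝ) 1 (fun y => chartCoord c V y i) x :=
  ContMDiffAt.comp (I' := 𝓘(ℝ, Plane)) x
    (EuclideanSpace.proj i : Plane →L[ℝ] ℝ).contDiff.contMDiff.contMDiffAt
    (contMDiffAt_chartCoord (by simp) hx hV)

/-- The weighted components `√(det g) Vⁱ` of a vector field in the chart at `c`. -/
def weightedCoord (c : M) (V : Π x : M, TangentSpace (𝓡 2) x) (i : Fin 2) (x : M) : ℝ :=
  volDensity c x * chartCoord c V x i

theorem contMDiffAt_weightedCoord {c x : M} (hx : x ∈ (chartAt Plane c).source)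
    {V : Π x : M, TangentSpace (𝓡 2) x} (hV : FieldAt 1 V x) (i : Fin 2) :
    ContMDiffAt (𝓡 2) 𝓘(ℝ, ℝ) 1 (weightedCoord c V i) x :=
  ((contMDiffAt_volDensity hx).of_le (by simp)).mul (mdifferentiableAt_chartCoord hx hV i)

/-- `√(det g) div V = ∂ᵢ (√(det g) Vⁱ)`. -/
theorem volDensity_mul_divergence {c x : M} (hx : x ∈ (chartAt Plane c).source)
    {V : Π x : M, TangentSpace (𝓡 2) x} (hV : FieldAt 1 V x) :
    volDensity c x * divergence (𝓡 2) V x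
      = ∑ i : Fin 2, mvfderiv (𝓡 2) (weightedCoord c V i) x
        (chartField c (EuclideanSpace.single i 1) x) := by
  set e : Fin 2 → Π x : M, TangentSpace (𝓡 2) x :=
    fun i => chartField c (EuclideanSpace.single i 1)
  have he : ∀ i, DiffFieldAt (e i) x := fun i => diffFieldAt_chartField hx _
  have hco : ∀ i, MDifferentiableAt (𝓡 2) 𝓘(ℝ, ℝ) (fun y => chartCoord c V y i) x :=
    fun i => (mdifferentiableAt_chartCoord hx hV i).mdifferentiableAt one_ne_zero
  have hev : V =ᶠ[𝓝 x] (fun y => chartCoord c V y 0) • e 0 + (fun y => chartCoord c V y 1) • e 1 := by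
    filter_upwards [(chartAt Plane c).open_source.mem_nhds hx] with y hy
    rw [← chartField_chartCoord hy V, chartField_eq_sum]
    rfl
  have hs : ∀ i, DiffFieldAt ((fun y => chartCoord c V y i) • e i) x :=
    fun i => (hco i).smul_section (he i)
  rw [divergence_congr (hV.mdifferentiableAt one_ne_zero) hev, divergence_add (hs 0) (hs 1),
    divergence_smul (hco 0) (he 0), divergence_smul (hco 1) (he 1), Fin.sum_univ_two]
  have hw : ∀ i, mvfderiv (𝓡 2) (weightedCoord c V i) x (e i x)
      = volDensity c x * mvfderiv (𝓡 2) (fun y => chartCoord c V y i) x (e i x)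
        + chartCoord c V x i * (volDensity c x * divergence (𝓡 2) (e i) x) := by
    intro i
    rw [← mvfderiv_volDensity hx]
    unfold weightedCoord
    rw [mvfderiv_fun_mul (mdifferentiableAt_volDensity hx) (hco i)]
    simp [e]
  rw [hw, hw]
  ring

/-- The coordinate formula for the divergence contains only first derivatives of C¹ functions,
divided by a positive continuous density. -/
theorem continuous_divergence {V : Π x : M, TangentSpace (𝓡 2) x} (hV : ∀ x, FieldAt 1 V x) :
    Continuous (divergence (𝓡 2) V) := by
  refine continuous_iff_continuousAt.2 fun c => ?_
  have hc := mem_chart_source Plane c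
  have hφ : ∀ i, ContinuousAt (fun x => fderiv ℝ (weightedCoord c V i ∘ (extChartAt (𝓡 2) c).symm)
      (extChartAt (𝓡 2) c x) (EuclideanSpace.single i 1)) c := by
    intro i
    have h1 : ContDiffOn ℝ 1 (weightedCoord c V i ∘ (extChartAt (𝓡 2) c).symm)
        (extChartAt (𝓡 2) c).target := by
      rw [← contMDiffOn_iff_contDiffOn]
      refine ContMDiffOn.comp (I' := 𝓡 2) (t := (extChartAt (𝓡 2) c).source) (fun x hx => ?_)
        ((contMDiffOn_extChartAt_symm (n := ∞) c).of_le (by simp))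
        (extChartAt (𝓡 2) c).mapsTo_symm
      exact (contMDiffAt_weightedCoord (by simpa using hx) (hV x) i).contMDiffWithinAt
    have h2 := (h1.continuousOn_fderiv_of_isOpen (isOpen_extChartAt_target c) le_rfl).continuousAt
      ((isOpen_extChartAt_target c).mem_nhds (mem_extChartAt_target c))
    exact (h2.comp (f := extChartAt (𝓡 2) c) (continuousAt_extChartAt c)).clm_apply
      continuousAt_const
  have key : ContinuousAt (fun x => (∑ i : Fin 2,
      fderiv ℝ (weightedCoord c V i ∘ (extChartAt (𝓡 2) c).symm)
      (extChartAt (𝓡 2) c x) (EuclideanSpace.single i 1)) / volDensity c x) c := by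
    refine ContinuousAt.div ?_ (contMDiffAt_volDensity hc).continuousAt (volDensity_pos hc).ne'
    simp only [Fin.sum_univ_two]
    exact (hφ 0).add (hφ 1)
  refine key.congr ?_
  filter_upwards [(chartAt Plane c).open_source.mem_nhds hc] with x hx
  rw [div_eq_iff (volDensity_pos hx).ne', mul_comm, volDensity_mul_divergence hx (hV x)]
  exact Finset.sum_congr rfl fun i _ => (mvfderiv_chartField hx
    ((contMDiffAt_weightedCoord hx (hV x) i).mdifferentiableAt one_ne_zero) _).symm

end Divergence
end GrossPitaevskii
end

noncomputable section

namespace GrossPitaevskii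

/-! ### From the plane to a closed surface: localisation of the divergence theorem. -/

section DivergenceTheorem

set_option linter.unusedSectionVars false

/-- Integration by parts against the constant function 1. -/
theorem integral_fderiv_eq_zero {K : Plane → ℝ} (hK : ContDiff ℝ 1 K) (hc : HasCompactSupport K)
    (a : Plane) : ∫ y, fderiv ℝ K y a = 0 := by
  have hcont : Continuous fun y => fderiv ℝ K y a :=
    (hK.continuous_fderiv one_ne_zero).clm_apply continuous_const
  have hi : Integrable (fun y => fderiv ℝ K y a) :=
    hcont.integrable_of_hasCompactSupport (hc.fderiv_apply ℝ a)
  have h := integral_mul_fderiv_eq_neg_fderiv_mul_of_integrable (μ := (volume : Measure Plane))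
    (f := fun _ : Plane => (1 : ℝ)) (g := K) (v := a) (by simp) (by simpa using hi)
    (by simpa using hK.continuous.integrable_of_hasCompactSupport hc)
    (fun x _ => differentiableAt_const _) (fun x _ => hK.differentiable one_ne_zero x)
  simpa using h

variable {M : Type*} [TopologicalSpace M] [T2Space M] [CompactSpace M]
  [ChartedSpace Plane M] [IsManifold (𝓡 2) ∞ M]
  [MeasurableSpace M] [BorelSpace M]
  [RiemannianBundle (fun x : M => TangentSpace (𝓡 2) x)]
  [IsContMDiffRiemannianBundle (𝓡 2) ∞ Plane (fun x : M => TangentSpace (𝓡 2) x)]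

theorem divergence_zero (x : M) :
    divergence (𝓡 2) (0 : Π x : M, TangentSpace (𝓡 2) x) x = 0 := by
  unfold divergence
  rw [CovariantDerivative.zero]
  exact map_zero _

theorem integrable_of_continuous {F : M → ℝ} (hF : Continuous F) :
    Integrable F (riemannianVolume M) :=
  hF.integrable_of_hasCompactSupport (HasCompactSupport.of_compactSpace F)

theorem weightedCoord_eq_zero {c x : M} {V : Π x : M, TangentSpace (𝓡 2) x} (h : V x = 0)
    (i : Fin 2) : weightedCoord c V i x = 0 := by
  simp [weightedCoord, chartCoord, h]

/-- The component `√(det g) Vⁱ` in the chart at `c`, extended by zero to the plane. -/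
def planeCoord (c : M) (V : Π x : M, TangentSpace (𝓡 2) x) (i : Fin 2) : Plane → ℝ :=
  (extChartAt (𝓡 2) c).target.indicator (weightedCoord c V i ∘ (extChartAt (𝓡 2) c).symm)

theorem planeCoord_eventuallyEq {c : M} {y : Plane} (hy : y ∈ (extChartAt (𝓡 2) c).target)
    (V : Π x : M, TangentSpace (𝓡 2) x) (i : Fin 2) :
    planeCoord c V i =ᶠ[𝓝 y] weightedCoord c V i ∘ (extChartAt (𝓡 2) c).symm := by
  filter_upwards [(isOpen_extChartAt_target (I := 𝓡 2) c).mem_nhds hy] with z hz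
  rw [planeCoord, indicator_of_mem hz]

variable {c : M} {K : Set M} {V : Π x : M, TangentSpace (𝓡 2) x}

theorem planeCoord_eq_zero (hVK : ∀ x ∉ K, V x = 0) (i : Fin 2) {y : Plane}
    (hy : y ∉ extChartAt (𝓡 2) c '' K) : planeCoord c V i y = 0 := by
  by_cases hyt : y ∈ (extChartAt (𝓡 2) c).target
  · rw [planeCoord, indicator_of_mem hyt]
    refine weightedCoord_eq_zero (hVK _ fun h => hy ⟨_, h, (extChartAt (𝓡 2) c).right_inv hyt⟩) i
  · rw [planeCoord, indicator_of_notMem hyt]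

theorem isCompact_image_chart (hK : IsClosed K) (hKc : K ⊆ (chartAt Plane c).source) :
    IsCompact (extChartAt (𝓡 2) c '' K) :=
  hK.isCompact.image_of_continuousOn
    ((continuousOn_extChartAt c).mono (by simpa using hKc))

/-- Extension by zero creates no singularity at the edge of the chart, because the function vanishes
off the compact image of `K`. -/
theorem contDiff_planeCoord (hK : IsClosed K) (hKc : K ⊆ (chartAt Plane c).source)
    (hVK : ∀ x ∉ K, V x = 0) (hV : ∀ x, FieldAt 1 V x) (i : Fin 2) :
    ContDiff ℝ 1 (planeCoord c V i) := by
  refine contDiff_iff_contDiffAt.2 fun y => ?_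
  by_cases hyt : y ∈ (extChartAt (𝓡 2) c).target
  · refine ContDiffAt.congr_of_eventuallyEq ?_ (planeCoord_eventuallyEq hyt V i)
    have hx : (extChartAt (𝓡 2) c).symm y ∈ (chartAt Plane c).source := by
      simpa using (extChartAt (𝓡 2) c).map_target hyt
    have h1 := ((contMDiffOn_extChartAt_symm (I := 𝓡 2) (n := ∞) c).of_le
      (m := 1) (by simp)).contMDiffAt ((isOpen_extChartAt_target c).mem_nhds hyt)
    exact ((contMDiffAt_weightedCoord hx (hV _) i).comp y h1).contDiffAt
  · have hy : y ∉ extChartAt (𝓡 2) c '' K := by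
      rintro ⟨x, hx, rfl⟩
      exact hyt ((extChartAt (𝓡 2) c).map_source (by simpa using hKc hx))
    refine (contDiffAt_const (c := (0 : ℝ))).congr_of_eventuallyEq ?_
    filter_upwards [(isCompact_image_chart hK hKc).isClosed.isOpen_compl.mem_nhds hy] with z hz
    exact planeCoord_eq_zero hVK i hz

/-- The volume density turns div V into a sum of partial derivatives of compactly supported
functions on the plane, each with integral zero. -/
theorem integral_divergence_of_support (hK : IsClosed K) (hKc : K ⊆ (chartAt Plane c).source)
    (hVK : ∀ x ∉ K, V x = 0) (hV : ∀ x, FieldAt 1 V x) :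
    ∫ x, divergence (𝓡 2) V x ∂(riemannianVolume M) = 0 := by
  have hsupp : ∀ x ∉ (chartAt Plane c).source, divergence (𝓡 2) V x = 0 := by
    intro x hx
    have hev : V =ᶠ[𝓝 x] (0 : Π x : M, TangentSpace (𝓡 2) x) := by
      filter_upwards [hK.isOpen_compl.mem_nhds fun h => hx (hKc h)] with y hy using hVK y hy
    rw [divergence_congr ((hV x).mdifferentiableAt one_ne_zero) hev, divergence_zero]
  have hT := (isOpen_extChartAt_target (I := 𝓡 2) c).measurableSet
  have hcs : ∀ i, HasCompactSupport (planeCoord c V i) := fun i =>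
    HasCompactSupport.intro (isCompact_image_chart hK hKc) fun y hy => planeCoord_eq_zero hVK i hy
  have hsm : ∀ i, ContDiff ℝ 1 (planeCoord c V i) := contDiff_planeCoord hK hKc hVK hV
  have hzero : ∀ y ∉ (extChartAt (𝓡 2) c).target, ∑ i : Fin 2,
      fderiv ℝ (planeCoord c V i) y (EuclideanSpace.single i 1) = 0 := by
    intro y hyt
    refine Finset.sum_eq_zero fun i _ => ?_
    have hy : y ∉ extChartAt (𝓡 2) c '' K := by
      rintro ⟨x, hx, rfl⟩
      exact hyt ((extChartAt (𝓡 2) c).map_source (by simpa using hKc hx))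
    have : planeCoord c V i =ᶠ[𝓝 y] fun _ => (0 : ℝ) := by
      filter_upwards [(isCompact_image_chart hK hKc).isClosed.isOpen_compl.mem_nhds hy] with z hz
      exact planeCoord_eq_zero hVK i hz
    rw [this.fderiv_eq]
    simp
  have hint : ∀ i a, Integrable (fun y => fderiv ℝ (planeCoord c V i) y a) := fun i a =>
    Continuous.integrable_of_hasCompactSupport
      (((hsm i).continuous_fderiv one_ne_zero).clm_apply continuous_const)
      ((hcs i).fderiv_apply ℝ a)
  calc ∫ x, divergence (𝓡 2) V x ∂(riemannianVolume M)
      = ∫ y in (extChartAt (𝓡 2) c).target, ∑ i : Fin 2,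
          fderiv ℝ (planeCoord c V i) y (EuclideanSpace.single i 1) := by
        rw [integral_riemannianVolume_of_support (continuous_divergence hV) hsupp]
        refine setIntegral_congr_fun hT fun y hy => ?_
        have hx : (extChartAt (𝓡 2) c).symm y ∈ (chartAt Plane c).source := by
          simpa using (extChartAt (𝓡 2) c).map_target hy
        rw [volDensity_mul_divergence hx (hV _)]
        refine Finset.sum_congr rfl fun i _ => ?_
        rw [mvfderiv_chartField hx ((contMDiffAt_weightedCoord hx (hV _) i).mdifferentiableAt
          one_ne_zero), (extChartAt (𝓡 2) c).right_inv hy,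
          (planeCoord_eventuallyEq hy V i).fderiv_eq]
    _ = ∫ y, ∑ i : Fin 2, fderiv ℝ (planeCoord c V i) y (EuclideanSpace.single i 1) :=
        setIntegral_eq_integral_of_forall_compl_eq_zero hzero
    _ = 0 := by
        rw [integral_finsetSum _ fun i _ => hint i _]
        exact Finset.sum_eq_zero fun i _ => integral_fderiv_eq_zero (hsm i) (hcs i) _

/-- **Divergence theorem** on a closed surface, for `C¹` vector fields. -/
theorem integral_divergence (hV : ∀ x, FieldAt 1 V x) :
    ∫ x, divergence (𝓡 2) V x ∂(riemannianVolume M) = 0 := by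
  obtain ⟨ρ, hρ⟩ := SmoothPartitionOfUnity.exists_isSubordinate_chartAt_source (𝓡 2) M
  have hfin : {i | (Function.support (ρ i)).Nonempty}.Finite :=
    ρ.locallyFinite.finite_nonempty_of_compact
  set s := hfin.toFinset
  have hsum : (fun x => ∑ i ∈ s, ρ i x) = fun _ => (1 : ℝ) := by
    funext x
    rw [← ρ.sum_eq_one (mem_univ x), finsum_eq_sum_of_support_subset]
    intro i hi
    simp only [s, Finite.coe_toFinset, mem_ofPred_eq]
    exact ⟨x, hi⟩
  have hsm : ∀ i, ContMDiff (𝓡 2) 𝓘(ℝ, ℝ) ∞ (ρ i) := fun i => (ρ i).contMDiff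
  have hone : ∀ i, ∫ x, divergence (𝓡 2) ((ρ i : M → ℝ) • V) x ∂(riemannianVolume M) = 0 := by
    intro i
    refine integral_divergence_of_support (c := i) (K := tsupport (ρ i)) (isClosed_tsupport _)
      (hρ i) (fun x hx => ?_) fun x => ?_
    · simp [image_eq_zero_of_notMem_tsupport hx]
    · exact (((hsm i).of_le (by simp)).contMDiffAt).smul_section (hV x)
  have hdiff : ∀ (t : Finset M) x, MDifferentiableAt (𝓡 2) 𝓘(ℝ, ℝ) (fun y => ∑ i ∈ t, ρ i y) x := by
    intro t x
    exact (contMDiff_finsetSum fun i _ => hsm i).contMDiffAt.mdifferentiableAt (by simp)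
  -- Only additivity of the divergence is needed to collapse the sum to that of (Σ ρᵢ)V = V; no
  -- derivatives of the ρᵢ have to be cancelled.
  have hd : ∀ (t : Finset M) x, ∑ i ∈ t, divergence (𝓡 2) ((ρ i : M → ℝ) • V) x
      = divergence (𝓡 2) ((fun y => ∑ i ∈ t, ρ i y) • V) x := by
    intro t x
    have hVx := (hV x).mdifferentiableAt one_ne_zero
    induction t using Finset.cons_induction with
    | empty =>
      have : ((fun y : M => ∑ i ∈ (∅ : Finset M), ρ i y) • V) = 0 := by
        funext y
        simp
      rw [this, divergence_zero, Finset.sum_empty]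
    | cons j t hj ih =>
      have hj' : MDifferentiableAt (𝓡 2) 𝓘(ℝ, ℝ) (ρ j) x :=
        (hsm j).contMDiffAt.mdifferentiableAt (by simp)
      have : ((fun y : M => ∑ i ∈ Finset.cons j t hj, ρ i y) • V)
          = (ρ j : M → ℝ) • V + (fun y : M => ∑ i ∈ t, ρ i y) • V := by
        funext y
        simp [add_smul]
      rw [Finset.sum_cons, ih, this, divergence_add (hj'.smul_section hVx)
        ((hdiff t x).smul_section hVx)]
  have hV1 : (fun x => ∑ i ∈ s, ρ i x) • V = V := by
    rw [hsum]
    funext x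
    simp
  calc ∫ x, divergence (𝓡 2) V x ∂(riemannianVolume M)
      = ∫ x, ∑ i ∈ s, divergence (𝓡 2) ((ρ i : M → ℝ) • V) x ∂(riemannianVolume M) := by
        simp_rw [hd, hV1]
    _ = ∑ i ∈ s, ∫ x, divergence (𝓡 2) ((ρ i : M → ℝ) • V) x ∂(riemannianVolume M) :=
        integral_finsetSum _ fun i _ => integrable_of_continuous (continuous_divergence fun x =>
          (((hsm i).of_le (by simp)).contMDiffAt).smul_section (hV x))
    _ = 0 := Finset.sum_eq_zero fun i _ => hone i

end DivergenceTheorem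
end GrossPitaevskii
end

noncomputable section

namespace GrossPitaevskii

section OrientedPlane

/-! ### Oriented Euclidean planes -/

variable {F : Type*} [NormedAddCommGroup F] [InnerProductSpace ℝ F]
  [Fact (Module.finrank ℝ F = 2)] (o : Orientation ℝ F (Fin 2))

/-- The area form is the determinant with respect to an orthonormal basis of orientation `o`. -/
theorem areaForm_basis_pos (b : Module.Basis (Fin 2) ℝ F) (hb : b.orientation = o) :
    0 < o.areaForm (b 0) (b 1) := by
  have he := o.finOrthonormalBasis_orientation two_pos (Fact.out : Module.finrank ℝ F = 2)
  rw [o.areaForm_to_volumeForm, o.volumeForm_robust _ he]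
  have hv : ![b 0, b 1] = b := by
    funext i
    fin_cases i <;> rfl
  rw [hv, ← Module.Basis.orientation_eq_iff_det_pos, he, hb]

theorem areaForm_sq (v w : F) :
    o.areaForm v w ^ 2 = inner ℝ v v * inner ℝ w w - inner ℝ v w ^ 2 := by
  have h := o.inner_sq_add_areaForm_sq v w
  rw [← real_inner_self_eq_norm_sq, ← real_inner_self_eq_norm_sq] at h
  linarith

open Classical in
theorem areaForm_basis (b : Module.Basis (Fin 2) ℝ F) :
    o.areaForm (b 0) (b 1) = (if b.orientation = o then 1 else -1)
      * Real.sqrt (inner ℝ (b 0) (b 0) * inner ℝ (b 1) (b 1) - inner ℝ (b 0) (b 1) ^ 2) := by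
  rw [← areaForm_sq o]
  split_ifs with h
  · rw [Real.sqrt_sq (areaForm_basis_pos o b h).le, one_mul]
  · have h' : b.orientation = -o := by
      rw [(b.orientation_ne_iff_eq_neg o).1 (Ne.symm h)]
      exact (neg_neg (G := Module.Ray ℝ (F [⋀^Fin 2]→ₗ[ℝ] ℝ)) b.orientation).symm
    have := areaForm_basis_pos (-o) b h'
    rw [o.areaForm_neg_orientation] at this
    have hneg : o.areaForm (b 0) (b 1) < 0 := by simpa using this
    rw [Real.sqrt_sq_eq_abs, abs_of_neg hneg]
    ring

/-- Writing the rotated first basis vector through metric coefficients, the area density and a sign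
`s` exhibits its smooth dependence on the point. -/
theorem rightAngleRotation_basis (b : Module.Basis (Fin 2) ℝ F) {s ρ : ℝ}
    (hω : o.areaForm (b 0) (b 1) = s * ρ) (hρ : ρ ≠ 0)
    (hsq : ρ ^ 2 = inner ℝ (b 0) (b 0) * inner ℝ (b 1) (b 1) - inner ℝ (b 0) (b 1) ^ 2) :
    o.rightAngleRotation (b 0)
      = (s * ρ⁻¹) • ((inner ℝ (b 0) (b 0) : ℝ) • b 1 + (-(inner ℝ (b 0) (b 1) : ℝ)) • b 0) := by
  refine InnerProductSpace.ext_inner_right_basis b fun i => ?_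
  rw [o.inner_rightAngleRotation_left]
  simp only [inner_add_left, inner_smul_left, conj_trivial]
  fin_cases i
  · simp only [Fin.zero_eta, o.areaForm_apply_self, real_inner_comm (b 0) (b 1)]
    ring
  · simp only [Fin.mk_one, hω]
    field_simp
    rw [hsq]
    ring

/-- Expansion in the orthogonal pair a, Ja. Keeping the factor |a|² on the left avoids normalising
and any hypothesis a ≠ 0. -/
theorem smul_eq_inner_add (a v : F) :
    (inner ℝ a a : ℝ) • v = (inner ℝ a v : ℝ) • a
      + (inner ℝ (o.rightAngleRotation a) v : ℝ) • o.rightAngleRotation a := by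
  refine ext_inner_right ℝ fun y => ?_
  have h := o.inner_mul_inner_add_areaForm_mul_areaForm a v y
  rw [← real_inner_self_eq_norm_sq] at h
  simp only [inner_add_left, inner_smul_left, o.inner_rightAngleRotation_left, conj_trivial]
  linarith

theorem eq_zero_of_inner {a v : F} (ha : a ≠ 0) (h1 : inner ℝ v a = (0 : ℝ))
    (h2 : inner ℝ v (o.rightAngleRotation a) = (0 : ℝ)) : v = 0 := by
  have h := smul_eq_inner_add o a v
  rw [real_inner_comm v a, h1, real_inner_comm v, h2, zero_smul, zero_smul, add_zero] at h
  exact (smul_eq_zero.1 h).resolve_left (real_inner_self_pos.2 ha).ne'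

/-- J is antisymmetric and S symmetric. In the basis v, Jv the two diagonal terms are opposite. -/
theorem trace_rotation_comp {v : F} (hv : v ≠ 0) (S : F →ₗ[ℝ] F)
    (hS : ∀ v w, inner ℝ (S v) w = (inner ℝ (S w) v : ℝ)) (T : F →ₗ[ℝ] F)
    (hT : ∀ v, T v = o.rightAngleRotation (S v)) : LinearMap.trace ℝ F T = 0 := by
  have key := trace_mul_gram (o.basisRightAngleRotation v hv) T
  have hb0 : o.basisRightAngleRotation v hv 0 = v := by simp
  have hb1 : o.basisRightAngleRotation v hv 1 = o.rightAngleRotation v := by simp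
  have hpos := real_inner_self_pos.2 hv
  have e0 : inner ℝ v (o.rightAngleRotation v) = (0 : ℝ) := by simp
  have e1 : inner ℝ (o.rightAngleRotation v) (o.rightAngleRotation v) = (inner ℝ v v : ℝ) :=
    o.inner_comp_rightAngleRotation v v
  have e2 : inner ℝ (T v) v = -(inner ℝ (S v) (o.rightAngleRotation v) : ℝ) := by
    rw [hT, o.inner_rightAngleRotation_swap']
  have e3 : inner ℝ (T (o.rightAngleRotation v)) (o.rightAngleRotation v)
      = (inner ℝ (S v) (o.rightAngleRotation v) : ℝ) := by
    rw [hT, o.inner_comp_rightAngleRotation, hS]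
  rw [hb0, hb1, e0, e1, e2, e3] at key
  have : LinearMap.trace ℝ F T * (inner ℝ v v * inner ℝ v v) = 0 := by linarith
  exact (mul_eq_zero.1 this).resolve_right (mul_pos hpos hpos).ne'

end OrientedPlane

section Gradient

/-! ### Regularity of gradients, symmetry of the Hessian, and parallelism of the rotation -/

set_option linter.unusedSectionVars false

variable {M : Type*} [TopologicalSpace M] [ChartedSpace Plane M] [IsManifold (𝓡 2) ∞ M]
  [RiemannianBundle (fun x : M => TangentSpace (𝓡 2) x)]
  [IsContMDiffRiemannianBundle (𝓡 2) ∞ Plane (fun x : M => TangentSpace (𝓡 2) x)]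

theorem inner_grad (f : M → ℝ) (x : M) (v : TangentSpace (𝓡 2) x) :
    inner ℝ (grad (𝓡 2) f x) v = mvfderiv (𝓡 2) f x v :=
  InnerProductSpace.toDual_symm_apply

theorem FieldAt.add {n : WithTop ℕ∞} (hn : n ≤ ∞) {V W : Π x : M, TangentSpace (𝓡 2) x} {x : M}
    (hV : FieldAt n V x) (hW : FieldAt n W x) : FieldAt n (V + W) x := by
  have : ContMDiffVectorBundle n Plane (TangentSpace (𝓡 2) : M → Type _) (𝓡 2) :=
    ContMDiffVectorBundle.of_le hn
  exact hV.add_section hW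

theorem FieldAt.smul {n : WithTop ℕ∞} (hn : n ≤ ∞) {V : Π x : M, TangentSpace (𝓡 2) x}
    {f : M → ℝ} {x : M} (hf : ContMDiffAt (𝓡 2) 𝓘(ℝ, ℝ) n f x) (hV : FieldAt n V x) :
    FieldAt n (f • V) x := by
  have : ContMDiffVectorBundle n Plane (TangentSpace (𝓡 2) : M → Type _) (𝓡 2) :=
    ContMDiffVectorBundle.of_le hn
  exact hf.smul_section hV

theorem FieldAt.congr {n : WithTop ℕ∞} {V W : Π x : M, TangentSpace (𝓡 2) x} {x : M}
    (hV : FieldAt n V x) (h : W =ᶠ[𝓝 x] V) : FieldAt n W x :=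
  hV.congr_of_eventuallyEq (h.mono fun y hy => by simp [hy])

variable (o : SurfaceOrientation M)

/-- The field `J V` obtained by rotating the field `V` by the angle `π/2`. -/
def rotate (V : Π x : M, TangentSpace (𝓡 2) x) (x : M) : TangentSpace (𝓡 2) x :=
  (o.orient x).rightAngleRotation (V x)

/-- The area form of a frame is ± the root of its Gram determinant; local constancy of the
orientation makes the sign constant near `c`. Smoothness of the rotation rests on this. -/
theorem exists_sign_areaForm (c : M) : ∃ s : ℝ, ∀ᶠ x in 𝓝 c,
    (o.orient x).areaForm (chartField c (EuclideanSpace.single 0 1) x)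
      (chartField c (EuclideanSpace.single 1 1) x) = s * volDensity c x := by
  classical
  set e := trivializationAt Plane (TangentSpace (𝓡 2) : M → Type _) c
  set o₀ := Orientation.map (Fin 2) (e.linearEquivAt ℝ c
    (FiberBundle.mem_baseSet_trivializationAt' c)) (o.orient c)
  set std := (EuclideanSpace.basisFun (Fin 2) ℝ).toBasis
  refine ⟨if std.orientation = o₀ then 1 else -1, ?_⟩
  filter_upwards [o.locally_constant c,
    (chartAt Plane c).open_source.mem_nhds (mem_chart_source Plane c)] with x hx hxc
  have hxe : x ∈ e.baseSet := by simpa [e] using hxc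
  have hor : Orientation.map (Fin 2) (e.linearEquivAt ℝ x hxe) (o.orient x) = o₀ := hx hxe
  -- Read in the trivialization, the coordinate frame becomes the standard basis and the orientation
  -- becomes `o₀`, neither of which depends on `x`.
  have hiff : (chartBasis hxc).orientation = o.orient x ↔ std.orientation = o₀ := by
    rw [← hor]
    change (std.map (e.linearEquivAt ℝ x hxe).symm).orientation = _ ↔ _
    rw [Module.Basis.orientation_map, ← Orientation.map_symm, Equiv.symm_apply_eq]
  have h := areaForm_basis (o.orient x) (chartBasis hxc)
  simp only [hiff, chartBasis_apply] at h
  exact h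

theorem fieldAt_rotate_chartField (c : M) :
    FieldAt ∞ (rotate o (chartField c (EuclideanSpace.single 0 1))) c := by
  obtain ⟨s, hs⟩ := exists_sign_areaForm o c
  have hc := mem_chart_source Plane c
  have hρ := contMDiffAt_volDensity hc
  have h0 := contMDiffAt_metricCoeff hc 0 0
  have h1 := contMDiffAt_metricCoeff hc 0 1
  have hinv : ContMDiffAt (𝓡 2) 𝓘(ℝ, ℝ) ∞ (fun x => s * (volDensity c x)⁻¹) c :=
    contMDiffAt_const.mul (hρ.inv₀ (volDensity_pos hc).ne')
  refine FieldAt.congr (V := (fun x => s * (volDensity c x)⁻¹) •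
    (metricCoeff c 0 0 • chartField c (EuclideanSpace.single 1 1)
      + (fun x => -metricCoeff c 0 1 x) • chartField c (EuclideanSpace.single 0 1))) ?_ ?_
  · exact FieldAt.smul le_rfl hinv ((FieldAt.smul le_rfl h0 (contMDiffAt_chartField hc _)).add le_rfl
      (FieldAt.smul le_rfl h1.neg (contMDiffAt_chartField hc _)))
  · filter_upwards [hs, (chartAt Plane c).open_source.mem_nhds hc] with x hx hxc
    have h := rightAngleRotation_basis (o.orient x) (chartBasis hxc) (s := s)
      (ρ := volDensity c x) (by simpa only [chartBasis_apply] using hx) (volDensity_pos hxc).ne'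
      (by simpa only [chartBasis_apply] using! Real.sq_sqrt (gramDet_pos hxc).le)
    simpa only [chartBasis_apply] using! h

/-- The expansion of a field in the frame `e, J e`, with `e` the first coordinate field. -/
theorem eq_frame {c x : M} (hx : x ∈ (chartAt Plane c).source) (v : TangentSpace (𝓡 2) x) :
    v = ((metricCoeff c 0 0 x)⁻¹ * inner ℝ (chartField c (EuclideanSpace.single 0 1) x) v) •
        chartField c (EuclideanSpace.single 0 1) x
      + ((metricCoeff c 0 0 x)⁻¹ *
          inner ℝ (rotate o (chartField c (EuclideanSpace.single 0 1)) x) v) •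
        rotate o (chartField c (EuclideanSpace.single 0 1)) x := by
  have h := smul_eq_inner_add (o.orient x) (chartField c (EuclideanSpace.single 0 1) x) v
  have hpos : 0 < metricCoeff c 0 0 x := real_inner_self_pos.2 (chartField_ne_zero hx (by simp))
  rw [mul_smul, mul_smul, ← smul_add]
  exact (eq_inv_smul_iff₀ hpos.ne').2 h

theorem contMDiffAt_inv_metricCoeff (c : M) :
    ContMDiffAt (𝓡 2) 𝓘(ℝ, ℝ) ∞ (fun x => (metricCoeff c 0 0 x)⁻¹) c := by
  have hc := mem_chart_source Plane c
  have hpos : 0 < metricCoeff c 0 0 c := real_inner_self_pos.2 (chartField_ne_zero hc (by simp))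
  exact (contMDiffAt_metricCoeff hc 0 0).inv₀ hpos.ne'

/-- A field is `C^n` if its inner products with the fields `e` and `J e` are. -/
theorem fieldAt_of_inner {n : WithTop ℕ∞} (hn : n ≤ ∞) {V : Π x : M, TangentSpace (𝓡 2) x} {c : M}
    (h0 : ContMDiffAt (𝓡 2) 𝓘(ℝ, ℝ) n
      (fun x => (inner ℝ (chartField c (EuclideanSpace.single 0 1) x) (V x) : ℝ)) c)
    (h1 : ContMDiffAt (𝓡 2) 𝓘(ℝ, ℝ) n
      (fun x => (inner ℝ (rotate o (chartField c (EuclideanSpace.single 0 1)) x) (V x) : ℝ)) c) :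
    FieldAt n V c := by
  have hc := mem_chart_source Plane c
  have hi := (contMDiffAt_inv_metricCoeff c).of_le hn
  refine FieldAt.congr (FieldAt.add hn
    (FieldAt.smul hn (hi.mul h0)
      ((contMDiffAt_chartField hc (EuclideanSpace.single 0 1)).of_le hn))
    (FieldAt.smul hn (hi.mul h1) ((fieldAt_rotate_chartField o c).of_le hn))) ?_
  filter_upwards [(chartAt Plane c).open_source.mem_nhds hc] with x hx
  exact eq_frame o hx (V x)

/-- The inner products of ∇f with the smooth frame e, Je are derivatives of `f` along these fields.
-/
theorem fieldAt_grad (o : SurfaceOrientation M) {n m : WithTop ℕ∞} (hnm : n + 1 ≤ m) (hn : n ≤ ∞) {f : M → ℝ}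
    (hf : ContMDiff (𝓡 2) 𝓘(ℝ, ℝ) m f) (x : M) : FieldAt n (grad (𝓡 2) f) x := by
  have hx := mem_chart_source Plane x
  refine fieldAt_of_inner o hn ?_ ?_
  · refine (contMDiffAt_mvfderiv_apply hnm hf ((contMDiffAt_chartField hx
      (EuclideanSpace.single 0 1)).of_le hn)).congr_of_eventuallyEq (.of_forall fun y => ?_)
    simp only
    rw [real_inner_comm, inner_grad]
  · refine (contMDiffAt_mvfderiv_apply hnm hf ((fieldAt_rotate_chartField o x).of_le
      hn)).congr_of_eventuallyEq (.of_forall fun y => ?_)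
    simp only
    rw [real_inner_comm, inner_grad]

/-- J is an antisymmetric isometry, so testing JV against e, Je amounts to testing V against -Je, e.
-/
theorem fieldAt_rotate {n : WithTop ℕ∞} (hn : n ≤ ∞) {V : Π x : M, TangentSpace (𝓡 2) x} {x : M}
    (hV : FieldAt n V x) : FieldAt n (rotate o V) x := by
  have hx := mem_chart_source Plane x
  have he : FieldAt n (chartField x (EuclideanSpace.single 0 1)) x :=
    (contMDiffAt_chartField hx _).of_le hn
  have hJe := (fieldAt_rotate_chartField o x).of_le hn
  refine fieldAt_of_inner o hn ?_ ?_
  · refine (contMDiffAt_inner hn hJe hV).neg.congr_of_eventuallyEq (.of_forall fun y => ?_)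
    simp [rotate]
  · refine (contMDiffAt_inner hn he hV).congr_of_eventuallyEq (.of_forall fun y => ?_)
    exact (o.orient y).inner_comp_rightAngleRotation _ _

/-! #### The rotation is parallel -/

theorem leviCivita_metric {X Y Z : Π x : M, TangentSpace (𝓡 2) x} {x : M}
    (hX : FieldAt 1 X x) (hY : FieldAt 1 Y x) (hZ : FieldAt 1 Z x) :
    mvfderiv (𝓡 2) (fun y => (inner ℝ (Y y) (Z y) : ℝ)) x (X x)
      = inner ℝ (leviCivita (𝓡 2) M Y x (X x)) (Z x)
        + inner ℝ (Y x) (leviCivita (𝓡 2) M Z x (X x)) :=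
  leviCivita_isMetricCompatible (hX.mdifferentiableAt one_ne_zero)
    (hY.mdifferentiableAt one_ne_zero) (hZ.mdifferentiableAt one_ne_zero)

theorem fieldAt_extend {x : M} (a : Plane) : FieldAt 1 (chartField x a) x :=
  (contMDiffAt_chartField (mem_chart_source Plane x) a).of_le (by simp)

/-- Differentiating |JY|² = |Y|² and ⟨JY, Y⟩ = 0 shows that ∇(JY) - J∇Y is orthogonal to JY and to
Y, which span the plane when Y ≠ 0. -/
theorem leviCivita_rotate_of_ne_zero {Y : Π x : M, TangentSpace (𝓡 2) x} {x : M}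
    (hY : FieldAt 1 Y x) (h0 : Y x ≠ 0) (v : TangentSpace (𝓡 2) x) :
    leviCivita (𝓡 2) M (rotate o Y) x v
      = (o.orient x).rightAngleRotation (leviCivita (𝓡 2) M Y x v) := by
  obtain ⟨a, rfl⟩ := exists_chartField_eq (mem_chart_source Plane x) v
  have hX := fieldAt_extend (x := x) a
  have hJ := fieldAt_rotate o (by simp) hY
  have h1 := leviCivita_metric hX hJ hJ
  have h2 := leviCivita_metric hX hY hY
  have h3 := leviCivita_metric hX hJ hY
  have e1 : (fun y => (inner ℝ (rotate o Y y) (rotate o Y y) : ℝ))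
      = fun y => (inner ℝ (Y y) (Y y) : ℝ) := by
    funext y
    exact (o.orient y).inner_comp_rightAngleRotation _ _
  have e3 : (fun y => (inner ℝ (rotate o Y y) (Y y) : ℝ)) = fun _ => 0 := by
    funext y
    exact (o.orient y).inner_rightAngleRotation_self _
  rw [e1, h2] at h1
  rw [e3, mvfderiv_const] at h3
  rw [← sub_eq_zero]
  set D := leviCivita (𝓡 2) M Y x (chartField x a x)
  set D' := leviCivita (𝓡 2) M (rotate o Y) x (chartField x a x)
  refine eq_zero_of_inner (o.orient x) h0 ?_ ?_
  · rw [inner_sub_left, (o.orient x).inner_rightAngleRotation_swap', sub_neg_eq_add,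
      real_inner_comm _ D]
    exact h3.symm
  · rw [inner_sub_left, (o.orient x).inner_comp_rightAngleRotation]
    rw [real_inner_comm D (Y x), real_inner_comm D' (rotate o Y x)] at h1
    have : inner ℝ D' ((o.orient x).rightAngleRotation (Y x)) = (inner ℝ D' (rotate o Y x) : ℝ) :=
      rfl
    rw [this]
    linarith

theorem leviCivita_rotate {Y : Π x : M, TangentSpace (𝓡 2) x} {x : M}
    (hY : FieldAt 1 Y x) (v : TangentSpace (𝓡 2) x) :
    leviCivita (𝓡 2) M (rotate o Y) x v
      = (o.orient x).rightAngleRotation (leviCivita (𝓡 2) M Y x v) := by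
  by_cases h0 : Y x = 0
  -- At a zero of Y, the nonvanishing case applies to E and to Y + E; subtract.
  · set E := chartField x (EuclideanSpace.single 0 1)
    have hE : FieldAt 1 E x := fieldAt_extend _
    have hE0 : E x ≠ 0 := chartField_ne_zero (mem_chart_source Plane x) (by simp)
    have hsum := leviCivita_rotate_of_ne_zero o (hY.add (by simp) hE) (by simpa [h0] using hE0) v
    have hone := leviCivita_rotate_of_ne_zero o hE hE0 v
    have hJ : rotate o (Y + E) = rotate o Y + rotate o E := by
      funext y
      simp [rotate]
    rw [hJ, leviCivita_add ((fieldAt_rotate o (by simp) hY).mdifferentiableAt one_ne_zero)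
      ((fieldAt_rotate o (by simp) hE).mdifferentiableAt one_ne_zero),
      leviCivita_add (hY.mdifferentiableAt one_ne_zero) (hE.mdifferentiableAt one_ne_zero),
      add_apply, add_apply, map_add, hone] at hsum
    exact add_right_cancel hsum
  · exact leviCivita_rotate_of_ne_zero o hY h0 v

/-! #### The Hessian -/

/-- In the chart these are the mixed second partial derivatives of a C² function. -/
theorem mvfderiv_mvfderiv_chartField_comm {f : M → ℝ} (hf : ContMDiff (𝓡 2) 𝓘(ℝ, ℝ) 2 f) {x : M}
    (a b : Plane) :
    mvfderiv (𝓡 2) (fun y => mvfderiv (𝓡 2) f y (chartField x b y)) x (chartField x a x)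
      = mvfderiv (𝓡 2) (fun y => mvfderiv (𝓡 2) f y (chartField x a y)) x (chartField x b x) := by
  have hx := mem_chart_source Plane x
  have hxt := mem_extChartAt_target (I := 𝓡 2) x
  set φ := extChartAt (𝓡 2) x
  have hF : ContDiffAt ℝ 2 (f ∘ φ.symm) (φ x) := by
    have h1 := ((contMDiffOn_extChartAt_symm (I := 𝓡 2) (n := ∞) x).of_le
      two_le_smooth).contMDiffAt ((isOpen_extChartAt_target x).mem_nhds hxt)
    exact (hf.contMDiffAt.comp _ h1).contDiffAt
  have hd : DifferentiableAt ℝ (fderiv ℝ (f ∘ φ.symm)) (φ x) :=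
    (hF.fderiv_right (m := 1) (by norm_num)).differentiableAt one_ne_zero
  have key : ∀ a b : Plane, mvfderiv (𝓡 2) (fun y => mvfderiv (𝓡 2) f y (chartField x b y)) x
      (chartField x a x) = fderiv ℝ (fderiv ℝ (f ∘ φ.symm)) (φ x) a b := by
    intro a b
    have hsm : ContMDiffAt (𝓡 2) 𝓘(ℝ, ℝ) 1 (fun y => mvfderiv (𝓡 2) f y (chartField x b y)) x :=
      contMDiffAt_mvfderiv_apply (by norm_num) hf (fieldAt_extend b)
    rw [mvfderiv_chartField hx (hsm.mdifferentiableAt one_ne_zero)]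
    have hev : (fun y => mvfderiv (𝓡 2) f y (chartField x b y)) ∘ φ.symm =ᶠ[𝓝 (φ x)]
        fun z => fderiv ℝ (f ∘ φ.symm) z b := by
      filter_upwards [(isOpen_extChartAt_target x).mem_nhds hxt] with z hz
      have hzs : φ.symm z ∈ (chartAt Plane x).source := by simpa [φ] using φ.map_target hz
      rw [Function.comp_apply, mvfderiv_chartField hzs
        (hf.contMDiffAt.mdifferentiableAt two_ne_zero)]
      change fderiv ℝ (f ∘ φ.symm) (φ (φ.symm z)) b = _
      rw [φ.right_inv hz]
    rw [hev.fderiv_eq, fderiv_clm_apply hd (differentiableAt_const _)]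
    simp
  rw [key, key]
  exact hF.isSymmSndFDerivAt (by simp) a b

/-- For coordinate fields, e_a(e_b f) = ⟨∇_{e_a}∇f, e_b⟩ + ⟨∇f, ∇_{e_a} e_b⟩. The left side and the
last term are symmetric in a, b. -/
theorem hessian_symm (o : SurfaceOrientation M) {f : M → ℝ} (hf : ContMDiff (𝓡 2) 𝓘(ℝ, ℝ) 2 f) (x : M)
    (v w : TangentSpace (𝓡 2) x) :
    inner ℝ (leviCivita (𝓡 2) M (grad (𝓡 2) f) x v) w
      = (inner ℝ (leviCivita (𝓡 2) M (grad (𝓡 2) f) x w) v : ℝ) := by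
  have hx := mem_chart_source Plane x
  obtain ⟨a, rfl⟩ := exists_chartField_eq hx v
  obtain ⟨b, rfl⟩ := exists_chartField_eq hx w
  have hg : FieldAt 1 (grad (𝓡 2) f) x := fieldAt_grad o (by norm_num) (by simp) hf x
  have h1 := leviCivita_metric (fieldAt_extend a) hg (fieldAt_extend b)
  have h2 := leviCivita_metric (fieldAt_extend b) hg (fieldAt_extend a)
  simp only [inner_grad f _ (chartField x _ _)] at h1 h2
  rw [mvfderiv_mvfderiv_chartField_comm hf, h2, leviCivita_chartField_comm hx] at h1
  linarith

/-- The sign is written as a constant function so that the Leibniz rules for function multiples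
apply. -/
theorem skewGrad_eq (η : M → ℝ) :
    skewGrad o η = (fun _ : M => (-1 : ℝ)) • rotate o (grad (𝓡 2) η) := by
  funext x
  simp [skewGrad, rotate]

theorem fieldAt_skewGrad {η : M → ℝ} (hη : ContMDiff (𝓡 2) 𝓘(ℝ, ℝ) ∞ η) (x : M) :
    FieldAt 1 (skewGrad o η) x := by
  rw [skewGrad_eq]
  exact FieldAt.smul (by simp) contMDiffAt_const (fieldAt_rotate o (by simp)
    (fieldAt_grad o (by norm_num; exact two_le_smooth) (by simp) hη x))

/-- Since J is parallel, ∇(J∇η) = J ∘ Hess η, which is traceless by symmetry of the Hessian. -/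
theorem divergence_skewGrad {η : M → ℝ} (hη : ContMDiff (𝓡 2) 𝓘(ℝ, ℝ) ∞ η) (x : M) :
    divergence (𝓡 2) (skewGrad o η) x = 0 := by
  have hη2 := hη.of_le two_le_smooth
  have hg : FieldAt 1 (grad (𝓡 2) η) x := fieldAt_grad o (by norm_num) (by simp) hη2 x
  rw [skewGrad_eq, divergence_smul mdifferentiableAt_const
    ((fieldAt_rotate o (by simp) hg).mdifferentiableAt one_ne_zero), mvfderiv_const, divergence,
    trace_rotation_comp (o.orient x)
      (chartField_ne_zero (mem_chart_source Plane x) (a := EuclideanSpace.single 0 1) (by simp))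
      (leviCivita (𝓡 2) M (grad (𝓡 2) η) x : TangentSpace (𝓡 2) x →ₗ[ℝ] TangentSpace (𝓡 2) x)
      (hessian_symm o hη2 x) _ (leviCivita_rotate o hg)]
  simp

end Gradient
end GrossPitaevskii
end

noncomputable section

namespace GrossPitaevskii

section IntegrationByParts

/-! ### Integration by parts along a divergence-free field -/

set_option linter.unusedSectionVars false

variable {M : Type*} [TopologicalSpace M] [ChartedSpace Plane M] [IsManifold (𝓡 2) ∞ M]

/-- The derivative `X f` of a function along a vector field. -/
def along (X : Π x : M, TangentSpace (𝓡 2) x) (f : M → ℝ) (x : M) : ℝ :=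
  mvfderiv (𝓡 2) f x (X x)

/-- A function of class `C^n`. -/
abbrev Smooth (n : WithTop ℕ∞) (f : M → ℝ) : Prop := ContMDiff (𝓡 2) 𝓘(ℝ, ℝ) n f

theorem Smooth.mdiff {f : M → ℝ} (hf : Smooth 1 f) (x : M) :
    MDifferentiableAt (𝓡 2) 𝓘(ℝ, ℝ) f x :=
  hf.contMDiffAt.mdifferentiableAt one_ne_zero

theorem Smooth.one {f : M → ℝ} (hf : Smooth 2 f) : Smooth 1 f :=
  hf.of_le (by norm_num)

variable {X : Π x : M, TangentSpace (𝓡 2) x} {f g : M → ℝ}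

theorem along_sub (hf : Smooth 1 f) (hg : Smooth 1 g) (x : M) :
    along X (fun y => f y - g y) x = along X f x - along X g x := by
  rw [along, mvfderiv_fun_sub (hf.mdiff x) (hg.mdiff x)]
  rfl

theorem along_add (hf : Smooth 1 f) (hg : Smooth 1 g) (x : M) :
    along X (fun y => f y + g y) x = along X f x + along X g x := by
  rw [along, mvfderiv_fun_add (hf.mdiff x) (hg.mdiff x)]
  rfl

theorem along_mul (hf : Smooth 1 f) (hg : Smooth 1 g) (x : M) :
    along X (fun y => f y * g y) x = f x * along X g x + g x * along X f x := by
  rw [along, mvfderiv_fun_mul (hf.mdiff x) (hg.mdiff x)]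
  rfl

theorem along_const_mul (r : ℝ) (hf : Smooth 1 f) (x : M) :
    along X (fun y => r * f y) x = r * along X f x := by
  rw [along_mul contMDiff_const hf, along, along, mvfderiv_const]
  simp

variable [RiemannianBundle (fun x : M => TangentSpace (𝓡 2) x)]
  [IsContMDiffRiemannianBundle (𝓡 2) ∞ Plane (fun x : M => TangentSpace (𝓡 2) x)]

theorem continuous_along (hX : ∀ x, FieldAt 1 X x) (hf : Smooth 1 f) : Continuous (along X f) :=
  continuous_iff_continuousAt.2 fun x =>
    (contMDiffAt_mvfderiv_apply (n := 0) (by simp) hf ((hX x).of_le (by simp))).continuousAt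

theorem contMDiff_along (hX : ∀ x, FieldAt 1 X x) (hf : Smooth 2 f) : Smooth 1 (along X f) :=
  fun x => contMDiffAt_mvfderiv_apply (by norm_num) hf (hX x)

theorem contMDiff_inner {V W : Π x : M, TangentSpace (𝓡 2) x} (hV : ∀ x, FieldAt 1 V x)
    (hW : ∀ x, FieldAt 1 W x) : Smooth 1 fun x => (inner ℝ (V x) (W x) : ℝ) :=
  fun x => contMDiffAt_inner (by simp) (hV x) (hW x)

theorem along_sq_le (x : M) :
    along X f x ^ 2 ≤ inner ℝ (X x) (X x) * inner ℝ (grad (𝓡 2) f x) (grad (𝓡 2) f x) := by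
  rw [along, ← inner_grad, sq, mul_comm (inner ℝ (X x) (X x) : ℝ)]
  exact real_inner_mul_inner_self_le _ _

variable (o : SurfaceOrientation M)

theorem fieldAt_grad_one (o : SurfaceOrientation M) (hf : Smooth 2 f) (x : M) :
    FieldAt 1 (grad (𝓡 2) f) x :=
  fieldAt_grad o (by norm_num) (by simp) hf x

theorem continuous_laplaceBeltrami (o : SurfaceOrientation M) (hf : Smooth 2 f) :
    Continuous (laplaceBeltrami (𝓡 2) f) :=
  continuous_divergence (fieldAt_grad_one o hf)

theorem laplaceBeltrami_sub (o : SurfaceOrientation M) (hf : Smooth 2 f) (hg : Smooth 2 g)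
    (x : M) : laplaceBeltrami (𝓡 2) (fun y => f y - g y) x
      = laplaceBeltrami (𝓡 2) f x - laplaceBeltrami (𝓡 2) g x := by
  have hgrad : grad (𝓡 2) (fun y => f y - g y)
      = grad (𝓡 2) f + (fun _ : M => (-1 : ℝ)) • grad (𝓡 2) g := by
    funext y
    rw [Pi.add_apply, Pi.smul_apply', neg_one_smul, ← sub_eq_add_neg, grad,
      mvfderiv_fun_sub (hf.one.mdiff y) (hg.one.mdiff y), map_sub, grad, grad]
  have h1 := (fieldAt_grad_one o hf x).mdifferentiableAt one_ne_zero
  have h2 := (fieldAt_grad_one o hg x).mdifferentiableAt one_ne_zero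
  have h3 : DiffFieldAt ((fun _ : M => (-1 : ℝ)) • grad (𝓡 2) g) x :=
    mdifferentiableAt_const.smul_section h2
  rw [laplaceBeltrami, hgrad, divergence_add h1 h3, divergence_smul mdifferentiableAt_const h2,
    mvfderiv_const, laplaceBeltrami, laplaceBeltrami]
  simp
  ring

/-- The identity behind the Pohozaev-type integration by parts: if `div X = 0` then
`⟪∇w, ∇_{∇w} X⟫ = div ((X w) ∇w - ½ |∇w|² X) - (X w) Δw`. -/
theorem inner_grad_leviCivita (o : SurfaceOrientation M) (hX : ∀ x, FieldAt 1 X x)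
    (hdiv : ∀ x, divergence (𝓡 2) X x = 0) (hf : Smooth 2 f) (x : M) :
    inner ℝ (grad (𝓡 2) f x) (leviCivita (𝓡 2) M X x (grad (𝓡 2) f x))
      = divergence (𝓡 2) (along X f • grad (𝓡 2) f) x
        - (1 / 2) * divergence (𝓡 2)
          ((fun y => (inner ℝ (grad (𝓡 2) f y) (grad (𝓡 2) f y) : ℝ)) • X) x
        - along X f x * laplaceBeltrami (𝓡 2) f x := by
  have hG := fieldAt_grad_one o hf
  rw [divergence_smul ((contMDiff_along hX hf).mdiff x) ((hG x).mdifferentiableAt one_ne_zero),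
    divergence_smul ((contMDiff_inner hG hG).mdiff x) ((hX x).mdifferentiableAt one_ne_zero),
    hdiv, leviCivita_metric (hX x) (hG x) (hG x)]
  have h1 : along X f = fun y => (inner ℝ (grad (𝓡 2) f y) (X y) : ℝ) := by
    funext y
    rw [inner_grad, along]
  have h2 := leviCivita_metric (hG x) (hG x) (hX x)
  rw [← h1] at h2
  have h3 := hessian_symm o hf x (X x) (grad (𝓡 2) f x)
  have h4 := real_inner_comm (leviCivita (𝓡 2) M (grad (𝓡 2) f) x (X x)) (grad (𝓡 2) f x)
  rw [h2, h4, h3, laplaceBeltrami]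
  ring

variable [T2Space M] [CompactSpace M] [MeasurableSpace M] [BorelSpace M]

/-- For divergence-free X, Xf = div(fX). -/
theorem integral_along (hX : ∀ x, FieldAt 1 X x) (hdiv : ∀ x, divergence (𝓡 2) X x = 0)
    (hf : Smooth 1 f) : ∫ x, along X f x ∂(riemannianVolume M) = 0 := by
  rw [← integral_divergence (V := f • X) fun x => FieldAt.smul (by simp) (hf x) (hX x)]
  congr 1
  funext x
  rw [divergence_smul (hf.mdiff x) ((hX x).mdifferentiableAt one_ne_zero), hdiv, along]
  ring

/-- Green's identity, from div(f∇f) = fΔf + |∇f|². -/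
theorem integral_grad_sq (o : SurfaceOrientation M) (hf : Smooth 2 f) :
    ∫ x, (inner ℝ (grad (𝓡 2) f x) (grad (𝓡 2) f x) : ℝ) ∂(riemannianVolume M)
      = -∫ x, f x * laplaceBeltrami (𝓡 2) f x ∂(riemannianVolume M) := by
  have hG := fieldAt_grad_one o hf
  have h := integral_divergence (V := f • grad (𝓡 2) f) fun x =>
    FieldAt.smul (by simp) (hf.one x) (hG x)
  have hd : divergence (𝓡 2) (f • grad (𝓡 2) f) = fun x => f x * laplaceBeltrami (𝓡 2) f x
      + inner ℝ (grad (𝓡 2) f x) (grad (𝓡 2) f x) := by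
    funext x
    rw [divergence_smul (hf.one.mdiff x) ((hG x).mdifferentiableAt one_ne_zero), inner_grad,
      laplaceBeltrami]
  have i1 : Integrable (fun x => f x * laplaceBeltrami (𝓡 2) f x) (riemannianVolume M) :=
    integrable_of_continuous (hf.continuous.mul (continuous_laplaceBeltrami o hf))
  rw [hd, integral_add i1 (integrable_of_continuous (contMDiff_inner hG hG).continuous)] at h
  linarith

/-- Through the Pohozaev identity, continuity follows from that of divergences of C¹ fields, without
discussing continuity of the endomorphism ∇X. -/
theorem continuous_inner_grad_leviCivita (o : SurfaceOrientation M) (hX : ∀ x, FieldAt 1 X x)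
    (hdiv : ∀ x, divergence (𝓡 2) X x = 0) (hf : Smooth 2 f) :
    Continuous fun x => (inner ℝ (grad (𝓡 2) f x)
      (leviCivita (𝓡 2) M X x (grad (𝓡 2) f x)) : ℝ) := by
  simp_rw [inner_grad_leviCivita o hX hdiv hf]
  have hG := fieldAt_grad_one o hf
  exact ((continuous_divergence fun x =>
      FieldAt.smul (by simp) (contMDiff_along hX hf x) (hG x)).sub
    (continuous_const.mul (continuous_divergence fun x =>
      FieldAt.smul (by simp) (contMDiff_inner hG hG x) (hX x)))).sub
    ((contMDiff_along hX hf).continuous.mul (continuous_laplaceBeltrami o hf))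

theorem integral_inner_grad_leviCivita (o : SurfaceOrientation M) (hX : ∀ x, FieldAt 1 X x)
    (hdiv : ∀ x, divergence (𝓡 2) X x = 0) (hf : Smooth 2 f) :
    ∫ x, (inner ℝ (grad (𝓡 2) f x) (leviCivita (𝓡 2) M X x (grad (𝓡 2) f x)) : ℝ)
        ∂(riemannianVolume M)
      = -∫ x, along X f x * laplaceBeltrami (𝓡 2) f x ∂(riemannianVolume M) := by
  simp_rw [inner_grad_leviCivita o hX hdiv hf]
  have hG := fieldAt_grad_one o hf
  have h1 : ∀ x, FieldAt 1 (along X f • grad (𝓡 2) f) x := fun x =>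
    FieldAt.smul (by simp) (contMDiff_along hX hf x) (hG x)
  have h2 : ∀ x, FieldAt 1
      ((fun y => (inner ℝ (grad (𝓡 2) f y) (grad (𝓡 2) f y) : ℝ)) • X) x := fun x =>
    FieldAt.smul (by simp) (contMDiff_inner hG hG x) (hX x)
  have i1 := integrable_of_continuous (continuous_divergence h1)
  have i2 := (integrable_of_continuous (continuous_divergence h2)).const_mul (1 / 2)
  have i3 : Integrable (fun x => along X f x * laplaceBeltrami (𝓡 2) f x) (riemannianVolume M) :=
    integrable_of_continuous
      ((contMDiff_along hX hf).continuous.mul (continuous_laplaceBeltrami o hf))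
  rw [integral_sub (by exact i1.sub i2) i3, integral_sub i1 i2, integral_const_mul,
    integral_divergence h1, integral_divergence h2]
  ring

end IntegrationByParts
end GrossPitaevskii
end

noncomputable section

namespace GrossPitaevskii

section Pairing

/-! ### The current of a complex-valued function along a divergence-free field -/

set_option linter.unusedSectionVars false

variable {M : Type*} [TopologicalSpace M] [ChartedSpace Plane M] [IsManifold (𝓡 2) ∞ M]

/-- The pairing `(i v) · X w`. -/
def pairing (X : Π x : M, TangentSpace (𝓡 2) x) (v w : M → ℂ) (x : M) : ℝ :=
  (v x).re * along X (fun y => (w y).im) x - (v x).im * along X (fun y => (w y).re) x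

theorem smooth_re {n : WithTop ℕ∞} {v : M → ℂ} (hv : ContMDiff (𝓡 2) 𝓘(ℝ, ℂ) n v) :
    Smooth n fun x => (v x).re :=
  Complex.reCLM.contDiff.contMDiff.comp hv

theorem smooth_im {n : WithTop ℕ∞} {v : M → ℂ} (hv : ContMDiff (𝓡 2) 𝓘(ℝ, ℂ) n v) :
    Smooth n fun x => (v x).im :=
  Complex.imCLM.contDiff.contMDiff.comp hv

variable {X : Π x : M, TangentSpace (𝓡 2) x}

/-- Polarization of the current: the difference of two currents, up to a derivative along `X`. -/
theorem pairing_self_sub {a b : M → ℂ} (ha : ContMDiff (𝓡 2) 𝓘(ℝ, ℂ) 1 a)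
    (hb : ContMDiff (𝓡 2) 𝓘(ℝ, ℂ) 1 b) (x : M) :
    pairing X a a x = pairing X b b x
      + 2 * pairing X (fun y => a y - b y) b x
      + pairing X (fun y => a y - b y) (fun y => a y - b y) x
      + along X (fun y => (b y).re * ((a y).im - (b y).im)
        - (b y).im * ((a y).re - (b y).re)) x := by
  have a1 := smooth_re ha
  have a2 := smooth_im ha
  have b1 := smooth_re hb
  have b2 := smooth_im hb
  have d1 : Smooth 1 fun y => (a y).re - (b y).re := a1.sub b1
  have d2 : Smooth 1 fun y => (a y).im - (b y).im := a2.sub b2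
  have m1 : Smooth 1 fun y => (b y).re * ((a y).im - (b y).im) := b1.mul d2
  have m2 : Smooth 1 fun y => (b y).im * ((a y).re - (b y).re) := b2.mul d1
  rw [along_sub m1 m2, along_mul b1 d2, along_mul b2 d1, along_sub a1 b1,
    along_sub a2 b2]
  simp only [pairing, Complex.sub_re, Complex.sub_im]
  rw [along_sub a1 b1, along_sub a2 b2]
  ring

variable [RiemannianBundle (fun x : M => TangentSpace (𝓡 2) x)]
  [IsContMDiffRiemannianBundle (𝓡 2) ∞ Plane (fun x : M => TangentSpace (𝓡 2) x)]

theorem inner_current (v : M → ℂ) (x : M) :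
    inner ℝ (current v x) (X x) = pairing X v v x := by
  simp only [current, inner_add_left, inner_smul_left, inner_grad, pairing, along, conj_trivial,
    Complex.mul_re, Complex.mul_im, Complex.I_re, Complex.I_im]
  ring

theorem continuous_pairing (hX : ∀ x, FieldAt 1 X x) {v w : M → ℂ} (hv : Continuous v)
    (hw : ContMDiff (𝓡 2) 𝓘(ℝ, ℂ) 1 w) : Continuous (pairing X v w) :=
  ((Complex.continuous_re.comp hv).mul (continuous_along hX (smooth_im hw))).sub
    ((Complex.continuous_im.comp hv).mul (continuous_along hX (smooth_re hw)))

/-- Cauchy-Schwarz |Xf|² ≤ |X|²|∇f|², then Young's inequality with a free weight δ that is tuned to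
the time increment later. -/
theorem abs_pairing_self_le {d : M → ℂ} {B K δ : ℝ} (x : M) (hδ : 0 < δ) (hB : ‖d x‖ ≤ B)
    (hK : inner ℝ (X x) (X x) ≤ K) :
    |pairing X d d x| ≤ B * δ + B * (K / (2 * δ)) *
      ((inner ℝ (grad (𝓡 2) (fun y => (d y).re) x) (grad (𝓡 2) (fun y => (d y).re) x) : ℝ)
        + inner ℝ (grad (𝓡 2) (fun y => (d y).im) x) (grad (𝓡 2) (fun y => (d y).im) x)) := by
  have hB0 : 0 ≤ B := (norm_nonneg _).trans hB
  have key : ∀ (f : M → ℝ) (r : ℝ), |r| ≤ B → |r * along X f x| ≤ B * (δ / 2)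
      + B * (K / (2 * δ)) * inner ℝ (grad (𝓡 2) f x) (grad (𝓡 2) f x) := by
    intro f r hr
    have h1 : along X f x ^ 2 ≤ K * inner ℝ (grad (𝓡 2) f x) (grad (𝓡 2) f x) :=
      (along_sq_le x).trans (mul_le_mul_of_nonneg_right hK real_inner_self_nonneg)
    have h2 : |along X f x| ≤ δ / 2 + along X f x ^ 2 / (2 * δ) := by
      rw [← sq_abs (along X f x), ← sub_nonneg]
      have : δ / 2 + |along X f x| ^ 2 / (2 * δ) - |along X f x|
          = (|along X f x| - δ) ^ 2 / (2 * δ) := by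
        field_simp
        ring
      rw [this]
      positivity
    rw [abs_mul]
    calc |r| * |along X f x| ≤ B * (δ / 2 + along X f x ^ 2 / (2 * δ)) :=
          mul_le_mul hr h2 (abs_nonneg _) hB0
      _ ≤ B * (δ / 2 + K * inner ℝ (grad (𝓡 2) f x) (grad (𝓡 2) f x) / (2 * δ)) := by gcongr
      _ = _ := by ring
  have h1 := key (fun y => (d y).im) (d x).re ((Complex.abs_re_le_norm _).trans hB)
  have h2 := key (fun y => (d y).re) (d x).im ((Complex.abs_im_le_norm _).trans hB)
  rw [pairing]
  refine (abs_sub _ _).trans ?_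
  linarith

variable [T2Space M] [CompactSpace M] [MeasurableSpace M] [BorelSpace M]

/-- In the pointwise polarization the defect of symmetry is a derivative along X, so it integrates
to zero. -/
theorem integral_pairing_self_sub (hX : ∀ x, FieldAt 1 X x)
    (hdiv : ∀ x, divergence (𝓡 2) X x = 0) {a b : M → ℂ}
    (ha : ContMDiff (𝓡 2) 𝓘(ℝ, ℂ) 1 a) (hb : ContMDiff (𝓡 2) 𝓘(ℝ, ℂ) 1 b) :
    ∫ x, pairing X a a x ∂(riemannianVolume M) = ∫ x, pairing X b b x ∂(riemannianVolume M)
      + 2 * ∫ x, pairing X (fun y => a y - b y) b x ∂(riemannianVolume M)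
      + ∫ x, pairing X (fun y => a y - b y) (fun y => a y - b y) x ∂(riemannianVolume M) := by
  have hd := ha.sub hb
  have hf := ((smooth_re hb).mul ((smooth_im ha).sub (smooth_im hb))).sub
    ((smooth_im hb).mul ((smooth_re ha).sub (smooth_re hb)))
  have i1 := integrable_of_continuous (continuous_pairing hX hb.continuous hb)
  have i2 := (integrable_of_continuous (continuous_pairing hX hd.continuous hb)).const_mul 2
  have i3 := integrable_of_continuous (continuous_pairing hX hd.continuous hd)
  have i4 := integrable_of_continuous (continuous_along hX hf)
  simp_rw [pairing_self_sub ha hb]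
  rw [integral_add (by exact (i1.add i2).add i3) (by exact i4), integral_add (by exact i1.add i2)
    (by exact i3), integral_add i1 (by exact i2), integral_const_mul, integral_along hX hdiv
    (by exact hf), add_zero]

/-- Green's identity trades the gradient, over which there is no uniform control in time, for sup
bounds on the function and its Laplacian. -/
theorem integral_grad_sq_le (o : SurfaceOrientation M) {f : M → ℝ} (hf : Smooth 2 f) {B L : ℝ}
    (hB : ∀ x, |f x| ≤ B) (hL : ∀ x, |laplaceBeltrami (𝓡 2) f x| ≤ L) (hB0 : 0 ≤ B) :
    ∫ x, (inner ℝ (grad (𝓡 2) f x) (grad (𝓡 2) f x) : ℝ) ∂(riemannianVolume M)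
      ≤ B * L * (riemannianVolume M).real univ := by
  rw [integral_grad_sq o hf]
  refine (neg_le_abs _).trans ?_
  rw [← Real.norm_eq_abs]
  refine norm_integral_le_of_norm_le_const (.of_forall fun x => ?_)
  rw [Real.norm_eq_abs, abs_mul]
  exact mul_le_mul (hB x) (hL x) (abs_nonneg _) hB0

theorem abs_integral_pairing_self_le (o : SurfaceOrientation M)
    {d : M → ℂ} (hd : ContMDiff (𝓡 2) 𝓘(ℝ, ℂ) 2 d) {B K L δ : ℝ} (hδ : 0 < δ)
    (hB0 : 0 ≤ B) (hK0 : 0 ≤ K) (hB : ∀ x, ‖d x‖ ≤ B) (hK : ∀ x, inner ℝ (X x) (X x) ≤ K)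
    (hL1 : ∀ x, |laplaceBeltrami (𝓡 2) (fun y => (d y).re) x| ≤ L)
    (hL2 : ∀ x, |laplaceBeltrami (𝓡 2) (fun y => (d y).im) x| ≤ L) :
    |∫ x, pairing X d d x ∂(riemannianVolume M)|
      ≤ B * (riemannianVolume M).real univ * (δ + K * B * L / δ) := by
  have h1 := smooth_re hd
  have h2 := smooth_im hd
  have c1 := (contMDiff_inner (fieldAt_grad_one o h1) (fieldAt_grad_one o h1)).continuous
  have c2 := (contMDiff_inner (fieldAt_grad_one o h2) (fieldAt_grad_one o h2)).continuous
  have i1 := integrable_of_continuous c1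
  have i2 := integrable_of_continuous c2
  have b1 := integral_grad_sq_le o h1 (fun x => (Complex.abs_re_le_norm _).trans (hB x)) hL1 hB0
  have b2 := integral_grad_sq_le o h2 (fun x => (Complex.abs_im_le_norm _).trans (hB x)) hL2 hB0
  rw [← Real.norm_eq_abs]
  refine (norm_integral_le_of_norm_le (g := fun x => B * δ + B * (K / (2 * δ)) *
      ((inner ℝ (grad (𝓡 2) (fun y => (d y).re) x) (grad (𝓡 2) (fun y => (d y).re) x) : ℝ)
        + inner ℝ (grad (𝓡 2) (fun y => (d y).im) x) (grad (𝓡 2) (fun y => (d y).im) x)))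
    (integrable_of_continuous (continuous_const.add (continuous_const.mul (c1.add c2))))
    (.of_forall fun x => abs_pairing_self_le x hδ (hB x) (hK x))).trans ?_
  have i3 : Integrable (fun x => B * (K / (2 * δ)) *
      ((inner ℝ (grad (𝓡 2) (fun y => (d y).re) x) (grad (𝓡 2) (fun y => (d y).re) x) : ℝ)
        + inner ℝ (grad (𝓡 2) (fun y => (d y).im) x) (grad (𝓡 2) (fun y => (d y).im) x)))
      (riemannianVolume M) := (i1.add i2).const_mul _
  rw [integral_add (integrable_const _) i3, integral_const,
    integral_const_mul, integral_add i1 i2, smul_eq_mul]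
  have hc : 0 ≤ B * (K / (2 * δ)) := by positivity
  refine (add_le_add le_rfl (mul_le_mul_of_nonneg_left (add_le_add b1 b2) hc)).trans (le_of_eq ?_)
  field_simp
  ring

end Pairing

section Evolution

/-! ### Evolution of the weak Jacobian -/

set_option linter.unusedSectionVars false

variable {M : Type*} [TopologicalSpace M] [T2Space M] [CompactSpace M]
  [ChartedSpace Plane M] [IsManifold (𝓡 2) ∞ M] [MeasurableSpace M] [BorelSpace M]
  [RiemannianBundle (fun x : M => TangentSpace (𝓡 2) x)]
  [IsContMDiffRiemannianBundle (𝓡 2) ∞ Plane (fun x : M => TangentSpace (𝓡 2) x)]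
  {ε : ℝ} {u₀ : M → ℂ} {u : ℝ → M → ℂ} {t : ℝ} {X : Π x : M, TangentSpace (𝓡 2) x}

/-- The window [t/2, 2t] is compact and stays away from time 0, where u_t is not controlled. -/
theorem mem_Icc_of_near {s : ℝ} (hs : s ∈ Metric.ball t (t / 2)) : s ∈ Icc (t / 2) (2 * t) := by
  rw [Metric.mem_ball, Real.dist_eq, abs_lt] at hs
  constructor <;> linarith [hs.1, hs.2]

namespace IsGrossPitaevskiiSolution

variable (hu : IsGrossPitaevskiiSolution ε u₀ u)
include hu

theorem exists_bound_deriv (ht : 0 < t) :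
    ∃ C, 0 ≤ C ∧ ∀ s ∈ Icc (t / 2) (2 * t), ∀ x, ‖deriv (fun r => u r x) s‖ ≤ C := by
  have hc : IsCompact (Icc (t / 2) (2 * t) ×ˢ (univ : Set M)) := isCompact_Icc.prod isCompact_univ
  obtain ⟨C, hC⟩ := hc.exists_bound_of_continuousOn (hu.continuousOn_deriv_time.mono
    (prod_mono_left fun s hs => lt_of_lt_of_le (by positivity) hs.1))
  exact ⟨max C 0, le_max_right _ _, fun s hs x =>
    (hC (s, x) ⟨hs, mem_univ x⟩).trans (le_max_left _ _)⟩

/-- No joint regularity of the spatial derivatives is assumed. The equation expresses Δu through u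
and u_t, which are jointly continuous, and compactness does the rest. -/
theorem exists_bound_laplace (ht : 0 < t) :
    ∃ L, 0 ≤ L ∧ ∀ s ∈ Icc (t / 2) (2 * t), ∀ x, ‖laplaceBeltramiC (u s) x‖ ≤ L := by
  have hc : IsCompact (Icc (t / 2) (2 * t) ×ˢ (univ : Set M)) := isCompact_Icc.prod isCompact_univ
  have hpos : ∀ s ∈ Icc (t / 2) (2 * t), 0 < s := fun s hs => lt_of_lt_of_le (by positivity) hs.1
  have h1 := hu.continuousOn_deriv_time.mono (prod_mono_left (t := (univ : Set M)) hpos)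
  have h2 := hu.continuousOn.mono (prod_mono_left (t := (univ : Set M)) fun s hs => (hpos s hs).le)
  have h3 : ContinuousOn (fun p : ℝ × M => Complex.I * deriv (fun s => u s p.2) p.1
      - u p.1 p.2 / (ε : ℂ) ^ 2 * (1 - (‖u p.1 p.2‖ : ℂ) ^ 2))
      (Icc (t / 2) (2 * t) ×ˢ (univ : Set M)) :=
    (continuousOn_const.mul h1).sub ((h2.div_const _).mul (continuousOn_const.sub
      ((Complex.continuous_ofReal.comp_continuousOn h2.norm).pow 2)))
  obtain ⟨L, hL⟩ := hc.exists_bound_of_continuousOn h3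
  refine ⟨max L 0, le_max_right _ _, fun s hs x => ?_⟩
  refine le_trans (le_of_eq ?_) ((hL (s, x) ⟨hs, mem_univ x⟩).trans (le_max_left _ _))
  simp only
  rw [← hu.equation s (hpos s hs) x]
  congr 1
  ring

theorem norm_sub_le {C : ℝ} (ht : 0 < t)
    (hC : ∀ s ∈ Icc (t / 2) (2 * t), ∀ x, ‖deriv (fun r => u r x) s‖ ≤ C)
    {s : ℝ} (hs : s ∈ Icc (t / 2) (2 * t)) (x : M) : ‖u s x - u t x‖ ≤ C * |s - t| :=
  (convex_Icc (t / 2) (2 * t)).norm_image_sub_le_of_norm_deriv_le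
    (fun r hr => hu.differentiableAt_time r (lt_of_lt_of_le (by positivity) hr.1) x)
    (fun r hr => hC r hr x) ⟨by linarith, by linarith⟩ hs

/-- Only undifferentiated values of u(s) vary; the X-derivatives fall on the fixed u(t). The bound
on u_t supplies the dominating function. -/
theorem hasDerivAt_integral_pairing_linear (ht : 0 < t) (hX : ∀ x, FieldAt 1 X x) :
    HasDerivAt (fun s => ∫ x, pairing X (fun y => u s y - u t y) (u t) x ∂(riemannianVolume M))
      (∫ x, pairing X (fun y => deriv (fun r => u r y) t) (u t) x ∂(riemannianVolume M)) t := by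
  have hw : ContMDiff (𝓡 2) 𝓘(ℝ, ℂ) 1 (u t) := (hu.contMDiff_space t ht).of_le (by norm_num)
  obtain ⟨C, hC0, hC⟩ := hu.exists_bound_deriv ht
  have c1 := continuous_along hX (smooth_im hw)
  have c2 := continuous_along hX (smooth_re hw)
  have hcont : ∀ s > 0, Continuous (u s) := fun s hs => (hu.contMDiff_space s hs).continuous
  have hball : ∀ s ∈ Metric.ball t (t / 2), 0 < s := fun s hs =>
    lt_of_lt_of_le (by positivity) (mem_Icc_of_near hs).1
  have hmeas : ∀ s > 0, Continuous (pairing X (fun y => u s y - u t y) (u t)) := fun s hs =>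
    continuous_pairing hX ((hcont s hs).sub (hcont t ht)) hw
  have hderivcont : Continuous fun y => deriv (fun r => u r y) t :=
    (hu.continuousOn_deriv_time.comp_continuous (f := fun y => (t, y)) (by fun_prop)
      fun y => ⟨ht, mem_univ y⟩)
  refine (hasDerivAt_integral_of_dominated_loc_of_deriv_le (μ := riemannianVolume M)
    (s := Metric.ball t (t / 2))
    (bound := fun x => C * |along X (fun y => (u t y).im) x|
      + C * |along X (fun y => (u t y).re) x|)
    (F' := fun s x => pairing X (fun y => deriv (fun r => u r y) s) (u t) x)
    (Metric.ball_mem_nhds t (by positivity)) ?_ ?_ ?_ ?_ ?_ ?_).2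
  · filter_upwards [Ioi_mem_nhds ht] with s hs
    exact (hmeas s hs).aestronglyMeasurable
  · exact integrable_of_continuous (hmeas t ht)
  · exact (continuous_pairing hX hderivcont hw).aestronglyMeasurable
  · refine .of_forall fun x s hs => ?_
    have h := hC s (mem_Icc_of_near hs) x
    rw [pairing, Real.norm_eq_abs]
    refine (abs_sub _ _).trans (add_le_add ?_ ?_)
    · rw [abs_mul]
      exact mul_le_mul_of_nonneg_right ((Complex.abs_re_le_norm _).trans h) (abs_nonneg _)
    · rw [abs_mul]
      exact mul_le_mul_of_nonneg_right ((Complex.abs_im_le_norm _).trans h) (abs_nonneg _)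
  · exact integrable_of_continuous ((continuous_const.mul c1.abs).add (continuous_const.mul c2.abs))
  · refine .of_forall fun x s hs => ?_
    have h := (hu.differentiableAt_time s (hball s hs) x).hasDerivAt.sub_const (u t x)
    have hre : HasDerivAt (fun r => (u r x - u t x).re) (deriv (fun r => u r x) s).re s :=
      Complex.reCLM.hasFDerivAt.comp_hasDerivAt s h
    have him : HasDerivAt (fun r => (u r x - u t x).im) (deriv (fun r => u r x) s).im s :=
      Complex.imCLM.hasFDerivAt.comp_hasDerivAt s h
    exact (hre.mul_const _).sub (him.mul_const _)

/-- The difference d is O(|s - t|) in sup norm but only O(|s - t|^{1/2}) in the L² norm of its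
gradient; the product is still o(|s - t|). -/
theorem hasDerivAt_integral_pairing_quadratic (o : SurfaceOrientation M) (ht : 0 < t)
    (hX : ∀ x, FieldAt 1 X x) :
    HasDerivAt (fun s => ∫ x, pairing X (fun y => u s y - u t y) (fun y => u s y - u t y) x
      ∂(riemannianVolume M)) 0 t := by
  obtain ⟨C, hC0, hC⟩ := hu.exists_bound_deriv ht
  obtain ⟨L, hL0, hL⟩ := hu.exists_bound_laplace ht
  obtain ⟨K, hK⟩ := isCompact_univ.exists_bound_of_continuousOn
    (contMDiff_inner hX hX).continuous.continuousOn
  have htI : t ∈ Icc (t / 2) (2 * t) := ⟨by linarith, by linarith⟩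
  set μ := (riemannianVolume M).real univ
  set K' := max K 0
  have hK' : ∀ x, (inner ℝ (X x) (X x) : ℝ) ≤ K' := fun x =>
    ((Real.le_norm_self _).trans (hK x (mem_univ x))).trans (le_max_left _ _)
  set A := C * μ * (1 + K' * C * (2 * L))
  have hbound : ∀ s ∈ Icc (t / 2) (2 * t), s ≠ t →
      |∫ x, pairing X (fun y => u s y - u t y) (fun y => u s y - u t y) x ∂(riemannianVolume M)|
        ≤ A * √|s - t| * |s - t| := by
    intro s hs hst
    have hs0 : 0 < s := lt_of_lt_of_le (by positivity) hs.1
    have hus := hu.contMDiff_space s hs0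
    have hut := hu.contMDiff_space t ht
    have hpos : 0 < |s - t| := abs_pos.2 (sub_ne_zero.2 hst)
    have hL1 : ∀ x, |laplaceBeltrami (𝓡 2) (fun y => (u s y - u t y).re) x| ≤ 2 * L := by
      intro x
      simp only [Complex.sub_re]
      rw [laplaceBeltrami_sub o (smooth_re hus) (smooth_re hut)]
      have h : ∀ r, laplaceBeltrami (𝓡 2) (fun y => (u r y).re) x
          = (laplaceBeltramiC (u r) x).re := fun r => by simp [laplaceBeltramiC]
      rw [h, h]
      have e1 := (Complex.abs_re_le_norm _).trans (hL s hs x)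
      have e2 := (Complex.abs_re_le_norm _).trans (hL t htI x)
      refine (abs_sub _ _).trans ?_
      linarith
    have hL2 : ∀ x, |laplaceBeltrami (𝓡 2) (fun y => (u s y - u t y).im) x| ≤ 2 * L := by
      intro x
      simp only [Complex.sub_im]
      rw [laplaceBeltrami_sub o (smooth_im hus) (smooth_im hut)]
      have h : ∀ r, laplaceBeltrami (𝓡 2) (fun y => (u r y).im) x
          = (laplaceBeltramiC (u r) x).im := fun r => by simp [laplaceBeltramiC]
      rw [h, h]
      have e1 := (Complex.abs_im_le_norm _).trans (hL s hs x)
      have e2 := (Complex.abs_im_le_norm _).trans (hL t htI x)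
      refine (abs_sub _ _).trans ?_
      linarith
    -- The weight δ = √|s - t| balances the two terms δ and KBL/δ, since B = C|s - t|. The Laplacian
    -- of a difference accounts for 2L.
    have h := abs_integral_pairing_self_le (X := X) (d := fun y => u s y - u t y) o
      (hus.sub hut) (Real.sqrt_pos.2 hpos) (mul_nonneg hC0 hpos.le) (le_max_right K 0)
      (fun x => hu.norm_sub_le ht hC hs x) hK' hL1 hL2
    refine h.trans (le_of_eq ?_)
    have hsq : √|s - t| ^ 2 = |s - t| := Real.sq_sqrt hpos.le
    have hsp := Real.sqrt_pos.2 hpos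
    change C * |s - t| * μ * (√|s - t| + K' * (C * |s - t|) * (2 * L) / √|s - t|) = _
    have hdiv : K' * (C * |s - t|) * (2 * L) / √|s - t| = K' * C * (2 * L) * √|s - t| := by
      rw [div_eq_iff hsp.ne']
      linear_combination (-(K' * C * (2 * L))) * hsq
    rw [hdiv]
    ring
  have hzero : ∫ x, pairing X (fun y => u t y - u t y) (fun y => u t y - u t y) x
      ∂(riemannianVolume M) = 0 := by simp [pairing]
  rw [hasDerivAt_iff_isLittleO, Asymptotics.isLittleO_iff]
  intro c hc
  have htend : Tendsto (fun s => A * √|s - t|) (𝓝 t) (𝓝 0) := by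
    have h : Continuous fun s : ℝ => A * √|s - t| := by fun_prop
    simpa using h.tendsto t
  filter_upwards [htend.eventually_lt_const hc, Metric.ball_mem_nhds t (half_pos ht)] with s h1 h2
  rw [hzero]
  by_cases hst : s = t
  · rw [hst, hzero]
    simp
  · simp only [sub_zero, smul_zero, Real.norm_eq_abs]
    exact (hbound s (mem_Icc_of_near h2) hst).trans
      (mul_le_mul_of_nonneg_right h1.le (abs_nonneg _))

/-- Take the real inner product of the equation with Xu. The nonlinear term ε⁻²(1 - |u|²) u·Xu is
the X-derivative of the potential ε⁻²(|u|²/2 - |u|⁴/4). -/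
theorem pairing_deriv (ht : 0 < t) (x : M) :
    pairing X (fun y => deriv (fun r => u r y) t) (u t) x
      = along X (fun y => (u t y).re) x * laplaceBeltrami (𝓡 2) (fun y => (u t y).re) x
        + along X (fun y => (u t y).im) x * laplaceBeltrami (𝓡 2) (fun y => (u t y).im) x
        + along X (fun y => (ε ^ 2)⁻¹ * ((1 / 2) * ((u t y).re * (u t y).re + (u t y).im * (u t y).im)
          - (1 / 4) * (((u t y).re * (u t y).re + (u t y).im * (u t y).im)
            * ((u t y).re * (u t y).re + (u t y).im * (u t y).im)))) x := by
  have hw : ContMDiff (𝓡 2) 𝓘(ℝ, ℂ) 1 (u t) := (hu.contMDiff_space t ht).of_le (by norm_num)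
  have p := smooth_re hw
  have q := smooth_im hw
  have pp : Smooth 1 fun y => (u t y).re * (u t y).re := p.mul p
  have qq : Smooth 1 fun y => (u t y).im * (u t y).im := q.mul q
  have hS : Smooth 1 fun y => (u t y).re * (u t y).re + (u t y).im * (u t y).im := pp.add qq
  have hSS : Smooth 1 fun y => ((u t y).re * (u t y).re + (u t y).im * (u t y).im)
      * ((u t y).re * (u t y).re + (u t y).im * (u t y).im) := hS.mul hS
  have hc : ∀ r : ℝ, Smooth 1 fun _ : M => r := fun r => contMDiff_const
  have h1 : Smooth 1 fun y => (1 / 2) * ((u t y).re * (u t y).re + (u t y).im * (u t y).im) :=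
    (hc _).mul hS
  have h2 : Smooth 1 fun y => (1 / 4) * (((u t y).re * (u t y).re + (u t y).im * (u t y).im)
      * ((u t y).re * (u t y).re + (u t y).im * (u t y).im)) := (hc _).mul hSS
  have h3 : Smooth 1 fun y => (1 / 2) * ((u t y).re * (u t y).re + (u t y).im * (u t y).im)
      - (1 / 4) * (((u t y).re * (u t y).re + (u t y).im * (u t y).im)
        * ((u t y).re * (u t y).re + (u t y).im * (u t y).im)) := h1.sub h2
  rw [along_const_mul _ h3, along_sub h1 h2, along_const_mul _ hS, along_const_mul _ hSS,
    along_mul hS hS, along_add pp qq, along_mul p p, along_mul q q]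
  have heq := hu.equation t ht x
  have hn : ((‖u t x‖ : ℂ)) ^ 2 = (((u t x).re * (u t x).re + (u t x).im * (u t x).im : ℝ) : ℂ) := by
    rw [← Complex.normSq_apply, Complex.normSq_eq_norm_sq]
    push_cast
    rfl
  have hR : u t x / (ε : ℂ) ^ 2 * (1 - (‖u t x‖ : ℂ) ^ 2)
      = (((ε ^ 2)⁻¹ * (1 - ((u t x).re * (u t x).re + (u t x).im * (u t x).im)) : ℝ) : ℂ)
        * u t x := by
    rw [hn]
    push_cast
    ring
  rw [hR] at heq
  have hre := congrArg Complex.re heq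
  have him := congrArg Complex.im heq
  rw [Complex.re_ofReal_mul] at hre
  rw [Complex.im_ofReal_mul] at him
  simp [laplaceBeltramiC] at hre him
  simp only [pairing]
  linear_combination (along X (fun y => (u t y).re) x) * hre
    + (along X (fun y => (u t y).im) x) * him

theorem integral_pairing_deriv (o : SurfaceOrientation M) (ht : 0 < t) (hX : ∀ x, FieldAt 1 X x)
    (hdiv : ∀ x, divergence (𝓡 2) X x = 0) :
    ∫ x, pairing X (fun y => deriv (fun r => u r y) t) (u t) x ∂(riemannianVolume M)
      = -∫ x, gradCovGrad (u t) X x ∂(riemannianVolume M) := by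
  have hw := hu.contMDiff_space t ht
  have p := smooth_re hw
  have q := smooth_im hw
  have p1 := p.one
  have q1 := q.one
  have hS := (p1.mul p1).add (q1.mul q1)
  have hc : ∀ r : ℝ, Smooth 1 fun _ : M => r := fun r => contMDiff_const
  have hG := (hc (ε ^ 2)⁻¹).mul (((hc (1 / 2)).mul hS).sub ((hc (1 / 4)).mul (hS.mul hS)))
  simp_rw [hu.pairing_deriv ht]
  have i1 := integrable_of_continuous
    ((continuous_along hX p1).mul (continuous_laplaceBeltrami o p))
  have i2 := integrable_of_continuous
    ((continuous_along hX q1).mul (continuous_laplaceBeltrami o q))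
  have i3 := integrable_of_continuous (continuous_along hX hG)
  rw [integral_add (by exact i1.add i2) (by exact i3), integral_add (by exact i1) (by exact i2),
    integral_along hX hdiv (by exact hG)]
  unfold gradCovGrad
  rw [integral_add (integrable_of_continuous (continuous_inner_grad_leviCivita o hX hdiv p))
    (integrable_of_continuous (continuous_inner_grad_leviCivita o hX hdiv q)),
    integral_inner_grad_leviCivita o hX hdiv p, integral_inner_grad_leviCivita o hX hdiv q]
  ring

end IsGrossPitaevskiiSolution

end Evolution
end GrossPitaevskii
end

/-! ### The evolution law for the weak Jacobian. -/

open GrossPitaevskii in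
theorem mainTheorem12 {M : Type*} [TopologicalSpace M] [T2Space M] [CompactSpace M]
    [SimplyConnectedSpace M] [ChartedSpace (EuclideanSpace ℝ (Fin 2)) M] [IsManifold (𝓡 2) ∞ M]
    [MeasurableSpace M] [BorelSpace M]
    [RiemannianBundle (fun x : M => TangentSpace (𝓡 2) x)]
    [IsContMDiffRiemannianBundle (𝓡 2) ∞ (EuclideanSpace ℝ (Fin 2))
      (fun x : M => TangentSpace (𝓡 2) x)]
    (o : SurfaceOrientation M) (ε : ℝ) (hε : 0 < ε) (u₀ : M → ℂ) (u : ℝ → M → ℂ)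
    (hu : IsGrossPitaevskiiSolution ε u₀ u)
    (η : M → ℝ) (hη : ContMDiff (𝓡 2) 𝓘(ℝ, ℝ) ∞ η) :
    ∀ t > 0,
      Integrable (fun x => (inner ℝ (current (u t) x) (skewGrad o η x) : ℝ))
        (riemannianVolume M) ∧
      Integrable (gradCovGrad (u t) (skewGrad o η)) (riemannianVolume M) ∧
      HasDerivAt (fun s => weakJacobian o (u s) η)
        (-∫ x, gradCovGrad (u t) (skewGrad o η) x ∂(riemannianVolume M)) t := by
  intro t ht
  have hX := fieldAt_skewGrad o hη
  have hdiv := divergence_skewGrad o hη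
  have hsmooth : ∀ s > 0, ContMDiff (𝓡 2) 𝓘(ℝ, ℂ) 1 (u s) := fun s hs =>
    (hu.contMDiff_space s hs).of_le (by norm_num)
  have hw := hu.contMDiff_space t ht
  refine ⟨?_, ?_, ?_⟩
  · simp_rw [inner_current]
    exact integrable_of_continuous (continuous_pairing hX hw.continuous (hsmooth t ht))
  · exact integrable_of_continuous
      ((continuous_inner_grad_leviCivita o hX hdiv (smooth_re hw)).add
        (continuous_inner_grad_leviCivita o hX hdiv (smooth_im hw)))
  · have h1 := hu.hasDerivAt_integral_pairing_linear ht hX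
    have h2 := hu.hasDerivAt_integral_pairing_quadratic o ht hX
    rw [hu.integral_pairing_deriv o ht hX hdiv] at h1
    -- Half of the polarized quadratic form: the value at time t, plus the linear term with
    -- coefficient 1, plus half of the quadratic term, which has zero derivative. The expansion
    -- needs u(s) to be C¹, hence holds for s > 0.
    have h3 := (h1.add (h2.const_mul (1 / 2 : ℝ))).const_add
      ((1 / 2 : ℝ) * ∫ x, pairing (skewGrad o η) (u t) (u t) x ∂(riemannianVolume M))
    rw [mul_zero, add_zero] at h3
    refine h3.congr_of_eventuallyEq ?_
    filter_upwards [Ioi_mem_nhds ht] with s hs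
    simp only [weakJacobian, inner_current, Pi.add_apply]
    rw [integral_pairing_self_sub hX hdiv (hsmooth s hs) (hsmooth t ht)]
    ring
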